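/- Let $\mathrm{Isom}(\mathbb R^2)$ be the group of maps $g=\tau_{v(g)}\circ\rho_{\theta(g)}$ of $\mathbb R^2\simeq\mathbb C$, $g(x)=e^{i\theta(g)}x+g(0)$, where $\theta(g)$ is the angle of rotation and $v(g)=g(0)$. Let $\mu$ be a probability measure on $\mathrm{Isom}(\mathbb R^2)$ with finite support which is symmetric (if $g$ has law $\mu$, then so has $g^{-1}$) and satisfies $\mathbb E_{g\sim\mu}\, g(0)=0$, and suppose that some $g\in\operatorname{supp}\mu$ satisfies $\cos\theta(g)\in\mathbb Q\setminus\frac12\mathbb Z$. Let $g_1,g_2,\dots$ be independent with law $\mu$, let $Y_N=(g_1g_2\cdots g_N)(0)$, and let $\sigma\ge 0$ be given by $\sigma^2=\frac12\mathbb E|g_1(0)|^2$. Then there are constants $c,C>0$, depending only on $\mu$, such that for all integers $N\ge 2$, all $x_0\in\mathbb R^2$ and all $r>\exp\bigl(-cN^{1/3}/(\log N)^2\bigr)$, $$\bigl|\mathbb P(Y_N\in B_r(x_0))-\mathbb P(\sigma\sqrt N\,Z_1\in B_r(x_0))\bigr|\le C N^{-3/2}r^2,$$ where $Z_1$ is a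 standard Gaussian on $\mathbb R^2$ and $B_r(x_0)$ is the open ball of radius $r$ about $x_0$. -/

import Mathlib

open MeasureTheory ProbabilityTheory

noncomputable section

namespace PlaneWalk

/-- The group `Isom(ℝ²)` of maps `τ_v ∘ ρ_θ` (a rotation followed by a translation), with `ℝ²`
identified with `ℂ`, as a subgroup of the group of all isometries of `ℂ` under composition. -/
def rigidMotions : Subgroup (ℂ ≃ᵢ ℂ) where
  carrier := {g | ∃ θ : ℝ, ∀ x : ℂ, g x = Complex.exp (θ * Complex.I) * x + g 0}
  one_mem' := ⟨0, fun x => by simp⟩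
  mul_mem' := by
    rintro g h ⟨α, hα⟩ ⟨β, hβ⟩
    refine ⟨α + β, fun x => ?_⟩
    rw [IsometryEquiv.mul_apply, IsometryEquiv.mul_apply, hα (h x), hβ x, hα (h 0)]
    push_cast
    rw [add_mul, Complex.exp_add]
    ring
  inv_mem' := by
    rintro g ⟨α, hα⟩
    have key : ∀ x : ℂ, g⁻¹ x = Complex.exp (-α * Complex.I) * (x - g 0) := fun x => by
      apply g.injective
      rw [IsometryEquiv.apply_inv_self, hα, ← mul_assoc, ← Complex.exp_add]
      simp
    refine ⟨-α, fun x => ?_⟩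
    rw [key x, key 0]
    push_cast
    ring

/-- The translation part `v(g) = g(0)`. -/
def trans (g : rigidMotions) : ℂ := (g : ℂ ≃ᵢ ℂ) 0

/-- The rotation angle `θ(g)`, normalised to lie in `(-π, π]`; note `e^{iθ(g)} = g(1) - g(0)`. -/
def angle (g : rigidMotions) : ℝ := Complex.arg ((g : ℂ ≃ᵢ ℂ) 1 - (g : ℂ ≃ᵢ ℂ) 0)

/-- The defining property of `θ(g)` and `v(g)`: `g = τ_{v(g)} ∘ ρ_{θ(g)}`. -/
theorem apply_eq (g : rigidMotions) (x : ℂ) :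
    (g : ℂ ≃ᵢ ℂ) x = Complex.exp (angle g * Complex.I) * x + trans g := by
  obtain ⟨g, θ, hθ⟩ := g
  have h1 : g 1 - g 0 = Complex.exp (θ * Complex.I) := by rw [hθ 1]; ring
  have h2 : Complex.exp (((g 1 - g 0).arg : ℂ) * Complex.I) = g 1 - g 0 := by
    have h := Complex.norm_mul_exp_arg_mul_I (g 1 - g 0)
    have hn : ‖g 1 - g 0‖ = 1 := by rw [h1, Complex.norm_exp_ofReal_mul_I]
    rwa [hn, Complex.ofReal_one, one_mul] at h
  simp only [angle, trans]
  rw [h2, h1]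
  exact hθ x

/-- `μ` is symmetric: if `g` has law `μ`, so has `g⁻¹`. -/
def IsSymmetric (μ : PMF rigidMotions) : Prop := μ.map (fun g => g⁻¹) = μ

/-- The law of `g₁ g₂ ⋯ g_N`, where `g₁, …, g_N` are independent with law `μ`. -/
def productLaw (μ : PMF rigidMotions) : ℕ → PMF rigidMotions
  | 0 => PMF.pure 1
  | N + 1 => (productLaw μ N).bind fun h => μ.map fun g => h * g

/-- The law of `Y_N = (g₁ g₂ ⋯ g_N)(0)`. -/
def walkLaw (μ : PMF rigidMotions) (N : ℕ) : PMF ℂ := (productLaw μ N).map trans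

/-- The drift `𝔼 g₁(0)`; a finite sum when `μ` has finite support. -/
def drift (μ : PMF rigidMotions) : ℂ := ∑' g, (μ g).toReal • trans g

/-- `σ`, where `σ² = ½ 𝔼 |g₁(0)|²`. -/
def sigma (μ : PMF rigidMotions) : ℝ :=
  Real.sqrt (1 / 2 * ∑' g, (μ g).toReal * ‖trans g‖ ^ 2)

end PlaneWalk

end

/-!
On the frequency circle of radius `s`, the characteristic function of `Y_N` is `A_s ^ N 1`, where
`A_s` averages over `μ` the unitary representation of `Isom(ℝ²)` on `L²` of the circle. It has to be
compared with the Gaussian `exp (-σ² s² N / 2)`.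

For `s` bounded away from `0`, `A_s` has a spectral gap of order `(1 + log s)⁻²`. If `A_s` nearly
preserves the norm of `f`, then `f` is nearly fixed by words in the quotients of steps, among them
a rotation by `z` with `B z² = A z - B`, where `A`, `B` are coprime and `B ≥ 2`, and a nonzero
translation. Integer polynomials in `z` take the value `z ^ k / B ^ k`, and expanding in base `z`
while dividing with remainder by `B` brings their coefficients down to size `B` and their degree
to `O(k)`. By Horner's scheme the translation by `x z ^ k / B ^ k` is therefore a word of length
`O(k)`. For `k ≈ log_B s` this translation has length `≈ 1 / s`, so it acts by a nontrivial
multiplier; two such translations in independent directions cannot both nearly fix `f`.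

For small `s`, a corrector of order `s²` in the second harmonics, which absorbs the anisotropy of
`μ`, makes the constant function an eigenvector up to `O(s³)` with eigenvalue
`exp (-σ² s² / 2)`.

Smoothing the ball at relative scale `N ^ (-1/2)` by a kernel whose Fourier transform decays like
`‖η‖⁻⁴` and cutting the frequencies at `exp (β N ^ (1/3))`, where the gap still gives
`exp (-c N ^ (1/3))`, leaves an error `O(N ^ (-3/2) r²)`.
-/

noncomputable section

namespace PlaneWalk

local notation "𝕋" => AddCircle (2 * Real.pi)

section Digits

open Polynomial

lemma abs_add_abs_le_norm_mul_add {z : ℂ} (hz : ‖z‖ = 1) (him : z.im ≠ 0) (a b : ℝ) :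
    |a| + |b| ≤ (1 + 2 / |z.im|) * ‖a * z + b‖ := by
  have ha : |a| ≤ ‖a * z + b‖ / |z.im| := by
    rw [le_div_iff₀ (abs_pos.mpr him), ← abs_mul]
    simpa using Complex.abs_im_le_norm (a * z + b)
  have hb : |b| ≤ ‖a * z + b‖ + |a| := by
    simpa [hz] using norm_sub_le (a * z + b) (a * z)
  calc |a| + |b| ≤ ‖a * z + b‖ + 2 * (‖a * z + b‖ / |z.im|) := by linarith
    _ = (1 + 2 / |z.im|) * ‖a * z + b‖ := by ring

lemma exists_eq_add_mul_abs_le_mul_nonneg (n : ℤ) {B : ℤ} (hB : 0 < B) (t : ℝ) :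
    ∃ q r : ℤ, n = r + B * q ∧ |r| ≤ B ∧ 0 ≤ r * t := by
  have habs (m : ℤ) : |m % B| ≤ B := by
    rw [abs_of_nonneg (Int.emod_nonneg _ hB.ne')]
    exact (Int.emod_lt_of_pos _ hB).le
  have hnonneg (m : ℤ) : (0 : ℝ) ≤ (m % B : ℤ) := by exact_mod_cast Int.emod_nonneg _ hB.ne'
  rcases le_total 0 t with ht | ht
  · exact ⟨n / B, n % B, (Int.emod_add_mul_ediv n B).symm, habs n, mul_nonneg (hnonneg n) ht⟩
  · refine ⟨-(-n / B), -(-n % B), by linarith [Int.emod_add_mul_ediv (-n) B], ?_, ?_⟩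
    · rw [abs_neg]
      exact habs (-n)
    · rw [Int.cast_neg]
      exact mul_nonneg_of_nonpos_of_nonpos (neg_nonpos.mpr (hnonneg (-n))) ht

lemma norm_sub_intCast_sq_le {w : ℂ} {r B : ℤ} (hr : |r| ≤ B) (hs : 0 ≤ r * w.re) :
    ‖w - r‖ ^ 2 ≤ ‖w‖ ^ 2 + (B : ℝ) ^ 2 := by
  have hr' : (r : ℝ) ^ 2 ≤ (B : ℝ) ^ 2 := sq_le_sq' (by exact_mod_cast neg_le_of_abs_le hr)
    (by exact_mod_cast le_of_abs_le hr)
  simp only [← Complex.normSq_eq_norm_sq, Complex.normSq_apply, Complex.sub_re, Complex.sub_im,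
    Complex.intCast_re, Complex.intCast_im]
  linarith

/-- The sign of the digit `r` is chosen so that removing it from `P(z)` moves towards the imaginary
axis: this is what makes the squared norm grow only additively. -/
lemma exists_aeval_eq_intCast_add_mul {z : ℂ} (hz : ‖z‖ = 1) {A B : ℤ} (hB : 0 < B)
    (hrel : B * z ^ 2 = A * z - B) {k : ℕ} {P : ℤ[X]} (hP : P.natDegree ≤ k + 2) :
    ∃ (r : ℤ) (Q : ℤ[X]), |r| ≤ B ∧ Q.natDegree ≤ k + 1 ∧ aeval z P = r + z * aeval z Q ∧
      ‖aeval z Q‖ ^ 2 ≤ ‖aeval z P‖ ^ 2 + (B : ℝ) ^ 2 := by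
  obtain ⟨q, r, hqr, hr, hs⟩ :=
    exists_eq_add_mul_abs_le_mul_nonneg (P.coeff 0) hB (aeval z P).re
  let Q : ℤ[X] := P.divX + C (q * A) - C (q * B) * X
  have hdeg : Q.natDegree ≤ k + 1 := by
    have hdivX : P.divX.natDegree ≤ k + 1 := by
      rw [natDegree_divX_eq_natDegree_tsub_one]
      omega
    have hlin : (C (q * B) * X).natDegree ≤ k + 1 :=
      (natDegree_C_mul_le _ _).trans (natDegree_X_le.trans (Nat.le_add_left 1 k))
    exact natDegree_sub_le_of_le (natDegree_add_le_of_le hdivX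
      ((natDegree_C _).le.trans (Nat.zero_le (k + 1)))) hlin |>.trans (by simp)
  have hval : aeval z P = r + z * aeval z Q := by
    have hdivX : aeval z P = aeval z P.divX * z + P.coeff 0 := by
      conv_lhs => rw [← divX_mul_X_add P]
      simp
    rw [hdivX, hqr]
    simp only [Q, map_sub, map_add, map_mul, aeval_X, eq_intCast, map_intCast, Int.cast_add,
      Int.cast_mul]
    linear_combination (q : ℂ) * hrel
  refine ⟨r, Q, hr, hdeg, hval, ?_⟩
  have hnorm : ‖aeval z Q‖ = ‖aeval z P - r‖ := by rw [hval]; simp [hz]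
  rw [hnorm]
  exact norm_sub_intCast_sq_le hr hs

lemma exists_natDegree_le_aeval_eq_pow_div_pow {z : ℂ} {A B : ℤ} (hB : B ≠ 0)
    (hAB : IsCoprime A B) (hrel : B * z ^ 2 = A * z - B) (k : ℕ) :
    ∃ P : ℤ[X], P.natDegree ≤ 2 * k ∧ aeval z P = z ^ k / B ^ k := by
  obtain ⟨u, w, huw⟩ := hAB
  refine ⟨(C u * (X ^ 2 + 1) + C w * X) ^ k, ?_, ?_⟩
  · rw [mul_comm 2]
    have hbase : (C u * (X ^ 2 + 1) + C w * X : ℤ[X]).natDegree ≤ 2 := by compute_degree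
    exact natDegree_pow_le_of_le k hbase
  · have huw' : (u : ℂ) * A + w * B = 1 := by exact_mod_cast huw
    rw [map_pow, ← div_pow]
    congr 1
    rw [eq_div_iff (Int.cast_ne_zero.mpr hB)]
    simp only [map_add, map_mul, map_pow, aeval_X, map_one, eq_intCast, map_intCast]
    linear_combination (u : ℂ) * hrel + z * huw'

variable {E : Type*} [AddCommGroup E] [Module ℂ E] (L : AddGroupSeminorm E) {z : ℂ} {d : ℝ}

lemma map_intCast_smul_le_abs_mul (n : ℤ) (x : E) : L ((n : ℂ) • x) ≤ |(n : ℝ)| * L x := by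
  let := L.toSeminormedAddCommGroup
  rw [Int.cast_smul_eq_zsmul, ← Int.norm_eq_abs]
  exact norm_zsmul_le n x

variable {L}

lemma map_aeval_smul_le_of_natDegree_le_one (hrot : ∀ x, L (z • x) ≤ L x + d) (hz : ‖z‖ = 1)
    (him : z.im ≠ 0) {P : ℤ[X]} (hP : P.natDegree ≤ 1) (x : E) :
    L (aeval z P • x) ≤ (1 + 2 / |z.im|) * ‖aeval z P‖ * L x + d := by
  obtain ⟨a, b, rfl⟩ := exists_eq_X_add_C_of_natDegree_le_one hP
  have hval : aeval z (C a * X + C b) = a * z + b := by simp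
  have hcoeff : |(a : ℝ)| + |(b : ℝ)| ≤ (1 + 2 / |z.im|) * ‖(a * z + b : ℂ)‖ := by
    simpa using abs_add_abs_le_norm_mul_add hz him a b
  rw [hval]
  calc L ((a * z + b : ℂ) • x) = L (z • (a : ℂ) • x + (b : ℂ) • x) := by
        rw [smul_smul, ← add_smul, mul_comm z]
    _ ≤ L ((a : ℂ) • x) + d + L ((b : ℂ) • x) :=
        (map_add_le_add L _ _).trans (by gcongr; exact hrot _)
    _ ≤ (|(a : ℝ)| + |(b : ℝ)|) * L x + d := by
        linarith [map_intCast_smul_le_abs_mul L a x, map_intCast_smul_le_abs_mul L b x]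
    _ ≤ (1 + 2 / |z.im|) * ‖(a * z + b : ℂ)‖ * L x + d := by
        have := apply_nonneg L x
        gcongr

lemma map_aeval_smul_le (hrot : ∀ x, L (z • x) ≤ L x + d) (hz : ‖z‖ = 1) (him : z.im ≠ 0)
    {A B : ℤ} (hB : 0 < B) (hrel : B * z ^ 2 = A * z - B) (x : E) (k : ℕ) :
    ∀ P : ℤ[X], P.natDegree ≤ k + 1 → L (aeval z P • x) ≤
      (1 + 2 / |z.im|) * √(‖aeval z P‖ ^ 2 + k * (B : ℝ) ^ 2) * L x + k * (B * L x + d) + d := by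
  have hLx := apply_nonneg L x
  induction k with
  | zero =>
    intro P hP
    simpa using map_aeval_smul_le_of_natDegree_le_one hrot hz him hP x
  | succ k ih =>
    intro P hP
    obtain ⟨r, Q, hr, hQ, hval, hnorm⟩ := exists_aeval_eq_intCast_add_mul hz hB hrel hP
    have hr' : |(r : ℝ)| ≤ B := by exact_mod_cast hr
    have hdigit : L (aeval z P • x) ≤ B * L x + d + L (aeval z Q • x) :=
      calc L (aeval z P • x) = L ((r : ℂ) • x + z • aeval z Q • x) := by
            rw [smul_smul, ← add_smul, hval]
        _ ≤ |(r : ℝ)| * L x + (L (aeval z Q • x) + d) :=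
            (map_add_le_add L _ _).trans
              (add_le_add (map_intCast_smul_le_abs_mul L r x) (hrot _))
        _ ≤ B * L x + d + L (aeval z Q • x) := by
            linarith [mul_le_mul_of_nonneg_right hr' hLx]
    have hmono : (1 + 2 / |z.im|) * √(‖aeval z Q‖ ^ 2 + k * (B : ℝ) ^ 2) * L x ≤
        (1 + 2 / |z.im|) * √(‖aeval z P‖ ^ 2 + (k + 1 : ℕ) * (B : ℝ) ^ 2) * L x := by
      gcongr ?_ * √(?_) * ?_
      push_cast
      linarith
    push_cast at hmono ⊢
    linarith [ih Q hQ]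

lemma map_pow_div_pow_smul_le (hrot : ∀ x, L (z • x) ≤ L x + d) (hz : ‖z‖ = 1) (him : z.im ≠ 0)
    {A B : ℤ} (hB : 0 < B) (hAB : IsCoprime A B) (hrel : B * z ^ 2 = A * z - B) (x : E) (k : ℕ) :
    L ((z ^ k / B ^ k : ℂ) • x) ≤ 4 * B * (1 + 2 / |z.im|) * (k + 1) * (L x + d) := by
  have hB1 : (1 : ℝ) ≤ B := by exact_mod_cast hB
  have hLx := apply_nonneg L x
  have hd : 0 ≤ d := by simpa using hrot 0
  have hk : (0 : ℝ) ≤ k := k.cast_nonneg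
  obtain ⟨P, hdeg, hval⟩ := exists_natDegree_le_aeval_eq_pow_div_pow hB.ne' hAB hrel k
  have hnorm : ‖aeval z P‖ ≤ 1 := by
    rw [hval, norm_div, norm_pow, norm_pow, hz, one_pow, Complex.norm_intCast,
      abs_of_pos (by linarith)]
    exact div_le_one_of_le₀ (one_le_pow₀ hB1) (by positivity)
  have hsqrt : √(‖aeval z P‖ ^ 2 + (2 * k : ℕ) * (B : ℝ) ^ 2) ≤ B * (2 * k + 1) := by
    refine Real.sqrt_le_iff.mpr ⟨by positivity, ?_⟩
    calc ‖aeval z P‖ ^ 2 + (2 * k : ℕ) * (B : ℝ) ^ 2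
        ≤ (B : ℝ) ^ 2 + 2 * k * (B : ℝ) ^ 2 := by
          push_cast
          gcongr
          exact hnorm.trans hB1
      _ ≤ ((B : ℝ) * (2 * k + 1)) ^ 2 := by
          rw [mul_pow, ← one_add_mul, mul_comm]
          gcongr
          nlinarith
  have hM : (1 : ℝ) ≤ 1 + 2 / |z.im| := le_add_of_nonneg_right (by positivity)
  have hdigits : (2 * k : ℝ) * (B * L x + d) + d ≤
      (1 + 2 / |z.im|) * (B * ((2 * k + 1) * (L x + d))) := by
    refine le_trans ?_ (le_mul_of_one_le_left (by positivity) hM)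
    have := le_mul_of_one_le_left (show 0 ≤ d * (2 * k + 1) by positivity) hB1
    nlinarith [mul_nonneg (zero_le_one.trans hB1) hLx]
  calc L ((z ^ k / B ^ k : ℂ) • x)
      ≤ (1 + 2 / |z.im|) * (B * (2 * k + 1)) * L x + (2 * k * (B * L x + d) + d) := by
        rw [← hval]
        refine (map_aeval_smul_le hrot hz him hB hrel x (2 * k) P (by omega)).trans ?_
        rw [add_assoc]
        push_cast at hsqrt ⊢
        gcongr
    _ ≤ B * (1 + 2 / |z.im|) * ((2 * k + 1) * (2 * L x + d)) := by linarith
    _ ≤ B * (1 + 2 / |z.im|) * (4 * (k + 1) * (L x + d)) := by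
        refine mul_le_mul_of_nonneg_left ?_ (by positivity)
        nlinarith [mul_nonneg hk hd, mul_nonneg hk hLx]
    _ = 4 * B * (1 + 2 / |z.im|) * (k + 1) * (L x + d) := by ring

end Digits

section RigidMotions

/-- The rotation part `e^{iθ(g)}` of a rigid motion, so that `g(x) = rot g * x + trans g`. -/
def rot (g : rigidMotions) : ℂ := Complex.exp (angle g * Complex.I)

lemma coe_apply_eq (g : rigidMotions) (x : ℂ) : (g : ℂ ≃ᵢ ℂ) x = rot g * x + trans g :=
  apply_eq g x

@[simp] lemma norm_rot (g : rigidMotions) : ‖rot g‖ = 1 := Complex.norm_exp_ofReal_mul_I _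

lemma rot_ne_zero (g : rigidMotions) : rot g ≠ 0 := Complex.exp_ne_zero _

lemma rot_eq_of_forall {g : rigidMotions} {a b : ℂ} (h : ∀ x, (g : ℂ ≃ᵢ ℂ) x = a * x + b) :
    rot g = a := by
  linear_combination h 1 - h 0 - coe_apply_eq g 1 + coe_apply_eq g 0

lemma trans_eq_of_forall {g : rigidMotions} {a b : ℂ} (h : ∀ x, (g : ℂ ≃ᵢ ℂ) x = a * x + b) :
    trans g = b := by
  linear_combination h 0 - coe_apply_eq g 0

lemma ext_rot_trans {g h : rigidMotions} (hr : rot g = rot h) (ht : trans g = trans h) :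
    g = h := by
  ext x
  rw [coe_apply_eq, coe_apply_eq, hr, ht]

lemma mul_coe_apply (g h : rigidMotions) (x : ℂ) : ((g * h : rigidMotions) : ℂ ≃ᵢ ℂ) x =
    rot g * rot h * x + (rot g * trans h + trans g) := by
  rw [Subgroup.coe_mul, IsometryEquiv.mul_apply, coe_apply_eq, coe_apply_eq]
  ring

lemma rot_mul (g h : rigidMotions) : rot (g * h) = rot g * rot h :=
  rot_eq_of_forall (mul_coe_apply g h)

lemma trans_mul (g h : rigidMotions) : trans (g * h) = rot g * trans h + trans g :=
  trans_eq_of_forall (mul_coe_apply g h)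

lemma one_coe_apply (x : ℂ) : ((1 : rigidMotions) : ℂ ≃ᵢ ℂ) x = 1 * x + 0 := by simp

@[simp] lemma rot_one : rot 1 = 1 := rot_eq_of_forall one_coe_apply

@[simp] lemma trans_one : trans 1 = 0 := trans_eq_of_forall one_coe_apply

lemma rot_inv (g : rigidMotions) : rot g⁻¹ = (rot g)⁻¹ :=
  eq_inv_of_mul_eq_one_left (by rw [← rot_mul, inv_mul_cancel, rot_one])

lemma trans_inv (g : rigidMotions) : trans g⁻¹ = -((rot g)⁻¹ * trans g) := by
  have h := trans_mul g⁻¹ g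
  rw [inv_mul_cancel, trans_one, rot_inv] at h
  linear_combination -h

/-- The translation `y ↦ y + x` as a rigid motion. -/
def translation (x : ℂ) : rigidMotions :=
  ⟨IsometryEquiv.addRight x, 0, fun y => by simp⟩

lemma translation_coe_apply (x y : ℂ) : (translation x : ℂ ≃ᵢ ℂ) y = 1 * y + x := by
  simp [translation]

@[simp] lemma rot_translation (x : ℂ) : rot (translation x) = 1 :=
  rot_eq_of_forall (translation_coe_apply x)

@[simp] lemma trans_translation (x : ℂ) : trans (translation x) = x :=
  trans_eq_of_forall (translation_coe_apply x)

lemma translation_zero : translation 0 = 1 := ext_rot_trans (by simp) (by simp)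

lemma translation_add (x y : ℂ) : translation (x + y) = translation x * translation y :=
  ext_rot_trans (by simp [rot_mul]) (by simp [trans_mul, add_comm])

lemma translation_neg (x : ℂ) : translation (-x) = (translation x)⁻¹ :=
  ext_rot_trans (by simp [rot_inv]) (by simp [trans_inv])

lemma translation_rot_mul (h : rigidMotions) (x : ℂ) :
    translation (rot h * x) = h * translation x * h⁻¹ := by
  rw [eq_mul_inv_iff_mul_eq]
  exact ext_rot_trans (by simp [rot_mul]) (by simp [trans_mul, add_comm])

/-- The translation vector of the commutator `g h g⁻¹ h⁻¹`, which is a translation. -/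
def commutatorTrans (g h : rigidMotions) : ℂ := (rot g - 1) * trans h - (rot h - 1) * trans g

lemma translation_commutatorTrans (g h : rigidMotions) :
    translation (commutatorTrans g h) = g * h * g⁻¹ * h⁻¹ := by
  rw [commutatorTrans, eq_mul_inv_iff_mul_eq, eq_mul_inv_iff_mul_eq]
  refine ext_rot_trans (by simp [rot_mul, mul_comm]) ?_
  simp only [trans_mul, rot_mul, rot_translation, trans_translation]
  ring

lemma exists_fixed_point {h : rigidMotions} (hrot : rot h ≠ 1) :
    ∃ p : ℂ, rot h * p + trans h = p := by
  have hsub : 1 - rot h ≠ 0 := sub_ne_zero.mpr hrot.symm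
  refine ⟨trans h / (1 - rot h), ?_⟩
  field_simp
  ring

lemma fixed_point_of_commutatorTrans_eq_zero {h k : rigidMotions} {p : ℂ} (hrot : rot h ≠ 1)
    (hp : rot h * p + trans h = p)
    (hcomm : commutatorTrans h k = 0) : rot k * p + trans k = p := by
  rw [commutatorTrans] at hcomm
  apply mul_left_cancel₀ (sub_ne_zero.mpr hrot)
  linear_combination hcomm + (rot k - 1) * hp

lemma apply_eq_apply_of_inv_mul_fixed_point {g h : rigidMotions} {p : ℂ}
    (hp : rot (g⁻¹ * h) * p + trans (g⁻¹ * h) = p) :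
    rot h * p + trans h = rot g * p + trans g := by
  rw [rot_mul, trans_mul, rot_inv, trans_inv] at hp
  have hg := rot_ne_zero g
  field_simp at hp
  linear_combination hp

lemma fixed_point_of_sq_fixed_point {g : rigidMotions} {p : ℂ} (hrot : rot g ^ 2 ≠ 1)
    (hp : rot (g * g) * p + trans (g * g) = p) : rot g * p + trans g = p := by
  rw [rot_mul, trans_mul] at hp
  have hne : rot g + 1 ≠ 0 := fun h => hrot (by rw [eq_neg_of_add_eq_zero_left h]; ring)
  apply mul_left_cancel₀ hne
  linear_combination hp

lemma sum_mul_ne_one_of_norm_eq_one {ι : Type*} {S : Finset ι} {w : ι → ℝ} {u : ι → ℂ}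
    (hw : ∀ i ∈ S, 0 < w i) (hsum : ∑ i ∈ S, w i = 1) (hu : ∀ i ∈ S, ‖u i‖ = 1) {j : ι}
    (hj : j ∈ S) (hne : u j ≠ 1) : ∑ i ∈ S, (w i : ℂ) * u i ≠ 1 := by
  intro h
  have hre : ∑ i ∈ S, w i * (1 - (u i).re) = 0 := by
    have := congrArg Complex.re h
    simp only [Complex.re_sum, Complex.re_ofReal_mul, Complex.one_re] at this
    simp only [mul_sub, mul_one, Finset.sum_sub_distrib, hsum, this, sub_self]
  have hzero := (Finset.sum_eq_zero_iff_of_nonneg fun i hi => mul_nonneg (hw i hi).le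
    (sub_nonneg.mpr ((Complex.re_le_norm _).trans (hu i hi).le))).mp hre j hj
  have hre_j : (u j).re = 1 :=
    (sub_eq_zero.mp ((mul_eq_zero.mp hzero).resolve_left (hw j hj).ne')).symm
  have him_j : (u j).im = 0 :=
    Complex.abs_re_eq_norm.mp (by rw [hre_j, hu j hj, abs_one])
  exact hne (Complex.ext hre_j him_j)

lemma trans_eq_zero_of_forall_fixed_point {S : Finset rigidMotions} {w : rigidMotions → ℝ}
    (hw : ∀ g ∈ S, 0 < w g) (hsum : ∑ g ∈ S, w g = 1)
    (hdrift : ∑ g ∈ S, (w g : ℂ) * trans g = 0) {g₀ : rigidMotions} (hg₀ : g₀ ∈ S)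
    (hrot : rot g₀ ≠ 1) {p : ℂ} (hp : ∀ g ∈ S, rot g * p + trans g = p) :
    ∀ g ∈ S, trans g = 0 := by
  have htrans : ∀ g ∈ S, trans g = (1 - rot g) * p := fun g hg => by
    linear_combination hp g hg
  have hmul : (1 - ∑ g ∈ S, (w g : ℂ) * rot g) * p = 0 := by
    have hone : (1 : ℂ) = ∑ g ∈ S, (w g : ℂ) := by exact_mod_cast hsum.symm
    rw [← hdrift, hone, ← Finset.sum_sub_distrib, Finset.sum_mul]
    exact Finset.sum_congr rfl fun g hg => by rw [htrans g hg]; ring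
  have hp0 : p = 0 := (mul_eq_zero.mp hmul).resolve_left <| sub_ne_zero.mpr <| Ne.symm <|
    sum_mul_ne_one_of_norm_eq_one hw hsum (fun g _ => norm_rot g) hg₀ hrot
  exact fun g hg => by rw [htrans g hg, hp0, mul_zero]

lemma exists_commutatorTrans_ne_zero {S : Finset rigidMotions} {w : rigidMotions → ℝ}
    (hw : ∀ g ∈ S, 0 < w g) (hsum : ∑ g ∈ S, w g = 1)
    (hdrift : ∑ g ∈ S, (w g : ℂ) * trans g = 0) {g₀ : rigidMotions} (hg₀ : g₀ ∈ S)
    (hinv : g₀⁻¹ ∈ S) (hrot : rot g₀ ^ 2 ≠ 1) (hne : ∃ g ∈ S, trans g ≠ 0) :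
    ∃ a ∈ S, ∃ b ∈ S, commutatorTrans (g₀ * g₀) (a⁻¹ * b) ≠ 0 := by
  by_contra! hcomm
  have hrot_sq : rot (g₀ * g₀) ≠ 1 := by rwa [rot_mul, ← sq]
  obtain ⟨p, hp⟩ := exists_fixed_point hrot_sq
  have hfix_inv_mul : ∀ a ∈ S, ∀ b ∈ S, rot (a⁻¹ * b) * p + trans (a⁻¹ * b) = p :=
    fun a ha b hb => fixed_point_of_commutatorTrans_eq_zero hrot_sq hp (hcomm a ha b hb)
  have hfix₀ : rot g₀ * p + trans g₀ = p :=
    fixed_point_of_sq_fixed_point hrot (by simpa using hfix_inv_mul _ hinv _ hg₀)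
  have hfix : ∀ g ∈ S, rot g * p + trans g = p := fun g hg =>
    (apply_eq_apply_of_inv_mul_fixed_point (hfix_inv_mul g₀ hg₀ g hg)).trans hfix₀
  obtain ⟨g, hg, hg'⟩ := hne
  exact hg' (trans_eq_zero_of_forall_fixed_point hw hsum hdrift hg₀
    (fun h => hrot (by rw [h, one_pow])) hfix g hg)

end RigidMotions

section RationalCosine

lemma exists_quadratic_relation_of_cos_rational {θ : ℝ} (hcos : ∃ q : ℚ, Real.cos θ = q)
    (hhalf : ∀ k : ℤ, Real.cos θ ≠ k / 2) :
    ∃ A B : ℤ, 2 ≤ B ∧ IsCoprime A B ∧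
      B * Complex.exp (θ * Complex.I) ^ 2 = A * Complex.exp (θ * Complex.I) - B := by
  obtain ⟨q, hq⟩ := hcos
  refine ⟨(2 * q).num, (2 * q).den, ?_, (2 * q).isCoprime_num_den, ?_⟩
  · have hden : (2 * q).den ≠ 1 := fun h => hhalf (2 * q).num <| by
      rw [hq, eq_div_iff two_ne_zero, mul_comm]
      exact_mod_cast ((Rat.den_eq_one_iff _).mp h).symm
    have := (2 * q).den_pos
    omega
  · have htwo : 2 * (q : ℂ) = Complex.exp (θ * Complex.I) + Complex.exp (-θ * Complex.I) := by
      rw [← Complex.two_cos, ← Complex.ofReal_cos, hq, Complex.ofReal_ratCast]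
    have hinv : Complex.exp (-θ * Complex.I) * Complex.exp (θ * Complex.I) = 1 := by
      rw [← Complex.exp_add, neg_mul, neg_add_cancel, Complex.exp_zero]
    have hden : 2 * (q : ℂ) * (2 * q).den = (2 * q).num := by
      exact_mod_cast Rat.mul_den_eq_num (2 * q)
    push_cast
    linear_combination Complex.exp (θ * Complex.I) * hden - hinv * (2 * q).den -
      (2 * q).den * Complex.exp (θ * Complex.I) * htwo

lemma sin_ne_zero_of_cos_ne_int_div_two {θ : ℝ} (hhalf : ∀ k : ℤ, Real.cos θ ≠ k / 2) :
    Real.sin θ ≠ 0 := by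
  rw [Ne, Real.sin_eq_zero_iff_cos_eq]
  rintro (h | h)
  · exact hhalf 2 (by rw [h]; norm_num)
  · exact hhalf (-2) (by rw [h]; norm_num)

lemma cos_two_mul_ne_int_div_two {θ : ℝ} (hcos : ∃ q : ℚ, Real.cos θ = q)
    (hhalf : ∀ k : ℤ, Real.cos θ ≠ k / 2) (k : ℤ) : Real.cos (2 * θ) ≠ k / 2 := by
  obtain ⟨q, hq⟩ := hcos
  intro h
  rw [Real.cos_two_mul, hq] at h
  have hsq : (2 * q) ^ 2 = (k + 2 : ℤ) := by
    have : (2 * (q : ℝ)) ^ 2 = (k + 2 : ℤ) := by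
      push_cast
      linear_combination 2 * h
    exact_mod_cast this
  have hden : (2 * q).den = 1 := by
    have := congrArg Rat.den hsq
    rw [Rat.den_pow, Rat.den_intCast] at this
    simpa using this
  apply hhalf (2 * q).num
  rw [hq, eq_div_iff two_ne_zero, mul_comm]
  exact_mod_cast ((Rat.den_eq_one_iff _).mp hden).symm

lemma exists_rat_cos_two_mul {θ : ℝ} (hcos : ∃ q : ℚ, Real.cos θ = q) :
    ∃ q : ℚ, Real.cos (2 * θ) = q := by
  obtain ⟨q, hq⟩ := hcos
  exact ⟨2 * q ^ 2 - 1, by rw [Real.cos_two_mul, hq]; push_cast; rfl⟩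

end RationalCosine

section CircleRepresentation

instance fact_two_pi_pos : Fact (0 < 2 * Real.pi) := ⟨Real.two_pi_pos⟩

/-- The point `e^{iα}` of the unit circle, as a complex number. -/
def phase (α : 𝕋) : ℂ := (AddCircle.toCircle α : Circle)

@[simp] lemma norm_phase (α : 𝕋) : ‖phase α‖ = 1 := Circle.norm_coe _

lemma phase_coe (t : ℝ) : phase (t : 𝕋) = Complex.exp (t * Complex.I) := by
  rw [phase, AddCircle.toCircle_apply_mk, Circle.coe_exp, div_self Real.two_pi_pos.ne', one_mul]

lemma phase_add (α β : 𝕋) : phase (α + β) = phase α * phase β := by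
  simp [phase, AddCircle.toCircle_add]

lemma phase_neg (α : 𝕋) : phase (-α) = (phase α)⁻¹ := by
  simp [phase, AddCircle.toCircle_neg]

@[fun_prop] lemma continuous_phase : Continuous phase :=
  continuous_subtype_val.comp AddCircle.continuous_toCircle

lemma phase_injective : Function.Injective phase := fun _ _ h =>
  AddCircle.injective_toCircle Real.two_pi_pos.ne' (Circle.ext h)

/-- The rotation angle of a rigid motion as an element of the circle `ℝ / 2πℤ`, where, unlike
`angle`, it is additive. -/
def rotAngle (g : rigidMotions) : 𝕋 := (angle g : ℝ)

@[simp] lemma phase_rotAngle (g : rigidMotions) : phase (rotAngle g) = rot g := phase_coe _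

lemma rotAngle_mul (g h : rigidMotions) : rotAngle (g * h) = rotAngle g + rotAngle h :=
  phase_injective (by simp only [phase_add, phase_rotAngle, rot_mul])

lemma rotAngle_eq_zero {g : rigidMotions} (h : rot g = 1) : rotAngle g = 0 :=
  phase_injective (by rw [phase_rotAngle, h]; simp [phase])

/-- The component of the vector `v` in the direction `e^{iα}`. -/
def component (v : ℂ) (α : 𝕋) : ℝ := inner ℝ v (phase α)

@[fun_prop] lemma continuous_component (v : ℂ) : Continuous (component v) := by
  unfold component
  fun_prop

lemma component_eq_re (v : ℂ) (α : 𝕋) : component v α = (phase α * (starRingEnd ℂ) v).re :=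
  Complex.inner v (phase α)

lemma abs_component_le (v : ℂ) (α : 𝕋) : |component v α| ≤ ‖v‖ :=
  (abs_real_inner_le_norm v (phase α)).trans_eq (by rw [norm_phase, mul_one])

lemma component_add (v w : ℂ) (α : 𝕋) : component (v + w) α = component v α + component w α :=
  inner_add_left v w (phase α)

lemma conj_rot (g : rigidMotions) : (starRingEnd ℂ) (rot g) = (rot g)⁻¹ :=
  (Complex.inv_eq_conj (norm_rot g)).symm

lemma component_sub_rotAngle (v : ℂ) (g : rigidMotions) (α : 𝕋) :
    component v (α - rotAngle g) = component (rot g * v) α := by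
  rw [component_eq_re, component_eq_re, sub_eq_add_neg, phase_add, phase_neg, phase_rotAngle,
    map_mul, conj_rot, mul_assoc]

/-- The unitary representation of the group of rigid motions attached to the radius `s`, acting on
functions on the circle. It is irreducible for `s ≠ 0`; `f (α)` plays the role of the value of a
function on the frequency circle of radius `s` at `s e^{iα}`. -/
def circleRep (s : ℝ) : Representation ℂ rigidMotions C(𝕋, ℂ) where
  toFun g :=
    { toFun f := ⟨fun α =>
        Complex.exp ((s * component (trans g) α : ℝ) * Complex.I) * f (α - rotAngle g), by
          fun_prop⟩
      map_add' f₁ f₂ := by ext α; simp [mul_add]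
      map_smul' c f := by ext α; simp [mul_left_comm] }
  map_one' := by
    ext f α
    simp [rotAngle_eq_zero rot_one, component]
  map_mul' g h := by
    ext f α
    simp only [LinearMap.coe_mk, AddHom.coe_mk, ContinuousMap.coe_mk, Module.End.mul_apply,
      component_sub_rotAngle, trans_mul, component_add, rotAngle_mul, ← mul_assoc,
      ← Complex.exp_add, sub_sub]
    congr 2
    push_cast
    ring

lemma circleRep_apply (s : ℝ) (g : rigidMotions) (f : C(𝕋, ℂ)) (α : 𝕋) : circleRep s g f α =
    Complex.exp ((s * component (trans g) α : ℝ) * Complex.I) * f (α - rotAngle g) := rfl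

lemma circleRep_translation_apply (s : ℝ) (x : ℂ) (f : C(𝕋, ℂ)) (α : 𝕋) :
    circleRep s (translation x) f α =
      Complex.exp ((s * component x α : ℝ) * Complex.I) * f α := by
  rw [circleRep_apply, rotAngle_eq_zero (rot_translation x), trans_translation, sub_zero]

lemma norm_circleRep_apply (s : ℝ) (g : rigidMotions) (f : C(𝕋, ℂ)) (α : 𝕋) :
    ‖circleRep s g f α‖ = ‖f (α - rotAngle g)‖ := by
  rw [circleRep_apply, norm_mul, Complex.norm_exp_ofReal_mul_I, one_mul]

/-- The `L²` norm of a continuous function on the circle, as a seminorm. The circle has total mass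
`2π`. -/
def l2 : Seminorm ℂ C(𝕋, ℂ) :=
  (normSeminorm ℂ (Lp ℂ 2 (volume : Measure 𝕋))).comp
    (ContinuousMap.toLp (E := ℂ) 2 (volume : Measure 𝕋) ℂ).toLinearMap

lemma l2_eq_norm_toLp (f : C(𝕋, ℂ)) :
    l2 f = ‖ContinuousMap.toLp (E := ℂ) 2 (volume : Measure 𝕋) ℂ f‖ := rfl

lemma l2_sq (f : C(𝕋, ℂ)) : l2 f ^ 2 = ∫ α, ‖f α‖ ^ 2 := by
  have hinner := ContinuousMap.inner_toLp (𝕜 := ℂ) (volume : Measure 𝕋) f f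
  rw [inner_self_eq_norm_sq_to_K, ← l2_eq_norm_toLp] at hinner
  have hcast : ((l2 f ^ 2 : ℝ) : ℂ) = ((∫ α, ‖f α‖ ^ 2 : ℝ) : ℂ) := by
    rw [← integral_complex_ofReal]
    push_cast
    refine hinner.trans (integral_congr_ae (ae_of_all _ fun α => ?_))
    simp [Complex.mul_conj']
  exact_mod_cast hcast

lemma integrable_of_continuous_circle {E : Type*} [NormedAddCommGroup E] {f : 𝕋 → E}
    (hf : Continuous f) : Integrable f :=
  hf.integrable_of_hasCompactSupport (HasCompactSupport.of_compactSpace f)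

lemma l2_circleRep (s : ℝ) (g : rigidMotions) (f : C(𝕋, ℂ)) : l2 (circleRep s g f) = l2 f := by
  rw [← sq_eq_sq₀ (apply_nonneg _ _) (apply_nonneg _ _), l2_sq, l2_sq]
  simp only [norm_circleRep_apply]
  exact integral_sub_right_eq_self (fun α => ‖f α‖ ^ 2) (rotAngle g)

lemma integral_const_circle (c : ℝ) : ∫ _ : 𝕋, c = 2 * Real.pi * c := by
  simp [Measure.real, AddCircle.measure_univ, Real.pi_pos.le]

lemma l2_le_of_norm_le {f : C(𝕋, ℂ)} {c : ℝ} (hc : 0 ≤ c) (hf : ∀ α, ‖f α‖ ≤ c) :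
    l2 f ≤ 3 * c := by
  refine le_of_sq_le_sq ?_ (by positivity)
  calc l2 f ^ 2 = ∫ α, ‖f α‖ ^ 2 := l2_sq f
    _ ≤ ∫ _ : 𝕋, c ^ 2 :=
        integral_mono (integrable_of_continuous_circle (by fun_prop)) (integrable_const _)
          fun α => pow_le_pow_left₀ (norm_nonneg _) (hf α) 2
    _ = 2 * Real.pi * c ^ 2 := integral_const_circle _
    _ ≤ (3 * c) ^ 2 := by nlinarith [Real.pi_lt_d2, sq_nonneg c]

end CircleRepresentation

section Variance

lemma norm_sum_smul_sq {ι H : Type*} [NormedAddCommGroup H] [InnerProductSpace ℂ H]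
    {S : Finset ι} {w : ι → ℝ} (hw : ∑ i ∈ S, w i = 1) (x : ι → H) :
    ‖∑ i ∈ S, (w i : ℂ) • x i‖ ^ 2 =
      ∑ i ∈ S, w i * ‖x i‖ ^ 2 - 1 / 2 * ∑ i ∈ S, ∑ j ∈ S, w i * w j * ‖x i - x j‖ ^ 2 := by
  have hexpand : ‖∑ i ∈ S, (w i : ℂ) • x i‖ ^ 2 =
      ∑ i ∈ S, ∑ j ∈ S, w i * w j * (inner ℂ (x i) (x j)).re := by
    rw [← inner_self_eq_norm_sq (𝕜 := ℂ), sum_inner]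
    simp_rw [inner_sum, inner_smul_left, inner_smul_right]
    simp [mul_assoc]
  have hleft : ∑ i ∈ S, ∑ j ∈ S, w i * w j * ‖x i‖ ^ 2 = ∑ i ∈ S, w i * ‖x i‖ ^ 2 :=
    Finset.sum_congr rfl fun i _ => by rw [← Finset.sum_mul, ← Finset.mul_sum, hw, mul_one]
  have hright : ∑ i ∈ S, ∑ j ∈ S, w i * w j * ‖x j‖ ^ 2 = ∑ i ∈ S, w i * ‖x i‖ ^ 2 := by
    rw [Finset.sum_comm, ← hleft]
    exact Finset.sum_congr rfl fun i _ => Finset.sum_congr rfl fun j _ => by rw [mul_comm (w j)]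
  have hcross : ∑ i ∈ S, ∑ j ∈ S, w i * w j * ‖x i - x j‖ ^ 2 =
      ∑ i ∈ S, ∑ j ∈ S, w i * w j * ‖x i‖ ^ 2 -
        2 * ∑ i ∈ S, ∑ j ∈ S, w i * w j * (inner ℂ (x i) (x j)).re +
        ∑ i ∈ S, ∑ j ∈ S, w i * w j * ‖x j‖ ^ 2 := by
    simp only [Finset.mul_sum, ← Finset.sum_sub_distrib, ← Finset.sum_add_distrib]
    refine Finset.sum_congr rfl fun i _ => Finset.sum_congr rfl fun j _ => ?_
    rw [norm_sub_sq (𝕜 := ℂ), RCLike.re_to_complex]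
    ring
  rw [hexpand, hcross, hleft, hright]
  ring

/-- The averaging operator `∑ w g • circleRep s g` of a random walk with step weights `w`, acting
on functions on the frequency circle of radius `s`. -/
def avg (s : ℝ) (S : Finset rigidMotions) (w : rigidMotions → ℝ) : C(𝕋, ℂ) →ₗ[ℂ] C(𝕋, ℂ) :=
  ∑ g ∈ S, (w g : ℂ) • circleRep s g

variable {s : ℝ} {S : Finset rigidMotions} {w : rigidMotions → ℝ}

lemma avg_eq_sum (f : C(𝕋, ℂ)) : avg s S w f = ∑ g ∈ S, (w g : ℂ) • circleRep s g f := by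
  simp [avg, LinearMap.sum_apply]

lemma avg_apply (f : C(𝕋, ℂ)) (α : 𝕋) :
    avg s S w f α = ∑ g ∈ S, (w g : ℂ) * circleRep s g f α := by
  simp [avg_eq_sum, ContinuousMap.sum_apply]

lemma l2_avg_sq (hsum : ∑ g ∈ S, w g = 1) (f : C(𝕋, ℂ)) :
    l2 (avg s S w f) ^ 2 = l2 f ^ 2 - 1 / 2 *
      ∑ g ∈ S, ∑ h ∈ S, w g * w h * l2 (circleRep s g f - circleRep s h f) ^ 2 := by
  have hvar := norm_sum_smul_sq hsum
    fun g => ContinuousMap.toLp (E := ℂ) 2 (volume : Measure 𝕋) ℂ (circleRep s g f)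
  simp_rw [← map_smul, ← map_sub, ← map_sum, map_smul, ← l2_eq_norm_toLp, ← avg_eq_sum,
    l2_circleRep] at hvar
  rwa [← Finset.sum_mul, hsum, one_mul] at hvar

lemma l2_circleRep_sub_circleRep_le (hw : ∀ g ∈ S, 0 < w g) (hsum : ∑ g ∈ S, w g = 1)
    (f : C(𝕋, ℂ)) {a b : rigidMotions} (ha : a ∈ S) (hb : b ∈ S) :
    w a * w b * l2 (circleRep s a f - circleRep s b f) ^ 2 ≤
      2 * (l2 f ^ 2 - l2 (avg s S w f) ^ 2) := by
  have hnonneg : ∀ g ∈ S, ∀ h ∈ S,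
      0 ≤ w g * w h * l2 (circleRep s g f - circleRep s h f) ^ 2 := fun g hg h hh =>
    mul_nonneg (mul_nonneg (hw g hg).le (hw h hh).le) (sq_nonneg _)
  have hsingle := (Finset.single_le_sum (hnonneg a ha) hb).trans
    (Finset.single_le_sum (fun g hg => Finset.sum_nonneg (hnonneg g hg)) ha)
  linarith [l2_avg_sq (s := s) hsum f]

end Variance

section Displacement

/-- How far the function `f` is moved by the rigid motion `g` in the representation of
radius `s`. -/
def disp (s : ℝ) (f : C(𝕋, ℂ)) (g : rigidMotions) : ℝ := l2 (circleRep s g f - f)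

variable {s : ℝ} {f : C(𝕋, ℂ)}

lemma disp_nonneg (g : rigidMotions) : 0 ≤ disp s f g := apply_nonneg _ _

@[simp] lemma disp_one : disp s f 1 = 0 := by simp [disp]

lemma disp_inv_mul (g h : rigidMotions) :
    disp s f (g⁻¹ * h) = l2 (circleRep s h f - circleRep s g f) := by
  rw [← l2_circleRep s g⁻¹, map_sub, ← Module.End.mul_apply, ← Module.End.mul_apply, ← map_mul,
    ← map_mul, inv_mul_cancel, map_one, Module.End.one_apply, disp]

lemma disp_inv (g : rigidMotions) : disp s f g⁻¹ = disp s f g := by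
  rw [← mul_one g⁻¹, disp_inv_mul, map_one, Module.End.one_apply, map_sub_rev, disp]

lemma disp_mul_le (g h : rigidMotions) : disp s f (g * h) ≤ disp s f g + disp s f h := by
  have hsplit : circleRep s (g * h) f - f =
      circleRep s g (circleRep s h f - f) + (circleRep s g f - f) := by
    rw [map_mul, Module.End.mul_apply, map_sub, sub_add_sub_cancel]
  calc disp s f (g * h)
      ≤ l2 (circleRep s g (circleRep s h f - f)) + l2 (circleRep s g f - f) := by
        rw [disp, hsplit]
        exact map_add_le_add l2 _ _
    _ = disp s f g + disp s f h := by rw [l2_circleRep, add_comm, disp, disp]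

lemma disp_mul_mul_inv_le (g h : rigidMotions) :
    disp s f (g * h * g⁻¹) ≤ disp s f h + 2 * disp s f g := by
  linarith [disp_mul_le (s := s) (f := f) (g * h) g⁻¹, disp_mul_le (s := s) (f := f) g h,
    disp_inv (s := s) (f := f) g]

lemma disp_commutator_le (g h : rigidMotions) :
    disp s f (g * h * g⁻¹ * h⁻¹) ≤ 2 * (disp s f g + disp s f h) := by
  linarith [disp_mul_le (s := s) (f := f) (g * h * g⁻¹) h⁻¹,
    disp_mul_mul_inv_le (s := s) (f := f) g h, disp_inv (s := s) (f := f) h]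

lemma disp_inv_mul_le {S : Finset rigidMotions} {w : rigidMotions → ℝ} {m : ℝ} (hm : 0 < m)
    (hmw : ∀ g ∈ S, m ≤ w g) (hsum : ∑ g ∈ S, w g = 1) {a b : rigidMotions} (ha : a ∈ S)
    (hb : b ∈ S) : m * disp s f (a⁻¹ * b) ≤ √(2 * (l2 f ^ 2 - l2 (avg s S w f) ^ 2)) := by
  have hw : ∀ g ∈ S, 0 < w g := fun g hg => hm.trans_le (hmw g hg)
  apply Real.le_sqrt_of_sq_le
  rw [disp_inv_mul, mul_pow, sq m]
  refine le_trans ?_ (l2_circleRep_sub_circleRep_le (s := s) hw hsum f hb ha)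
  gcongr
  exacts [(hw b hb).le, hmw b hb, hmw a ha]

/-- The displacement of `f` under translations, as a seminorm on the group of translations. -/
def translationDisp (s : ℝ) (f : C(𝕋, ℂ)) : AddGroupSeminorm ℂ where
  toFun x := disp s f (translation x)
  map_zero' := by rw [translation_zero, disp_one]
  add_le' x y := by rw [translation_add]; exact disp_mul_le _ _
  neg' x := by rw [translation_neg, disp_inv]

lemma translationDisp_apply (x : ℂ) : translationDisp s f x = disp s f (translation x) := rfl

lemma translationDisp_rot_mul_le (h : rigidMotions) (x : ℂ) :
    translationDisp s f (rot h * x) ≤ translationDisp s f x + 2 * disp s f h := by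
  rw [translationDisp_apply, translation_rot_mul]
  exact disp_mul_mul_inv_le _ _

lemma translationDisp_commutator_le (g h : rigidMotions) :
    translationDisp s f (commutatorTrans g h) ≤ 2 * (disp s f g + disp s f h) := by
  rw [translationDisp_apply, translation_commutatorTrans]
  exact disp_commutator_le _ _

lemma translationDisp_sq (x : ℂ) : translationDisp s f x ^ 2 =
    ∫ α, ‖Complex.exp ((s * component x α : ℝ) * Complex.I) - 1‖ ^ 2 * ‖f α‖ ^ 2 := by
  rw [translationDisp_apply, disp, l2_sq]
  refine integral_congr_ae (ae_of_all _ fun α => ?_)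
  simp only [ContinuousMap.sub_apply, circleRep_translation_apply]
  rw [← mul_pow, ← norm_mul, sub_mul, one_mul]

lemma half_abs_le_norm_exp_sub_one {t : ℝ} (ht : |t| ≤ 1) :
    |t| / 2 ≤ ‖Complex.exp (t * Complex.I) - 1‖ := by
  have hpi := Real.pi_lt_four
  rw [mul_comm, Complex.norm_exp_I_mul_ofReal_sub_one, Real.norm_eq_abs, abs_mul, abs_two]
  have hhalf : |t / 2| = |t| / 2 := by rw [abs_div, abs_two]
  have hjordan : 2 / Real.pi * |t / 2| ≤ |Real.sin (t / 2)| :=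
    Real.mul_abs_le_abs_sin (by linarith [Real.pi_gt_three])
  have hconst : 1 / 2 ≤ 2 / Real.pi := by
    rw [div_le_div_iff₀ two_pos Real.pi_pos]
    linarith
  rw [hhalf] at hjordan
  nlinarith [abs_nonneg t]

lemma sq_im_mul_sq_norm_le {z : ℂ} (hz : ‖z‖ = 1) (x : ℂ) (α : 𝕋) :
    z.im ^ 2 * ‖x‖ ^ 2 ≤ 2 * (component x α ^ 2 + component (z * x) α ^ 2) := by
  set p : ℂ := x * (starRingEnd ℂ) (phase α) with hp
  have hcomponent : ∀ y, component y α = (y * (starRingEnd ℂ) (phase α)).re := fun y => by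
    rw [component_eq_re, ← Complex.conj_re]
    simp [mul_comm]
  have hnorm : ‖x‖ ^ 2 = p.re ^ 2 + p.im ^ 2 := by
    rw [← Complex.sq_norm_sub_sq_re, add_sub_cancel, hp, norm_mul, RCLike.norm_conj, norm_phase,
      mul_one]
  have hz_sq : z.re ^ 2 + z.im ^ 2 = 1 := by
    rw [← Complex.sq_norm_sub_sq_re, hz, one_pow, add_sub_cancel]
  rw [hcomponent, hcomponent (z * x), mul_assoc, ← hp, hnorm]
  clear_value p
  rw [Complex.mul_re]
  have him_sq : z.im ^ 2 = 1 - z.re ^ 2 := eq_sub_of_add_eq' hz_sq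
  calc z.im ^ 2 * (p.re ^ 2 + p.im ^ 2)
      = (z.re * p.re - (z.re * p.re - z.im * p.im)) ^ 2 + z.im ^ 2 * p.re ^ 2 := by ring
    _ ≤ 2 * (z.re ^ 2 * p.re ^ 2 + (z.re * p.re - z.im * p.im) ^ 2) + z.im ^ 2 * p.re ^ 2 := by
        linarith [sq_nonneg (z.re * p.re + (z.re * p.re - z.im * p.im))]
    _ ≤ 2 * (p.re ^ 2 + (z.re * p.re - z.im * p.im) ^ 2) := by
        rw [him_sq]
        nlinarith [mul_nonneg (sq_nonneg z.im) (sq_nonneg p.re)]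

lemma sq_mul_le_norm_exp_component {y : ℂ} (hs : 0 ≤ s) (hy : s * ‖y‖ ≤ 1) (α : 𝕋) :
    s ^ 2 * component y α ^ 2 ≤
      4 * ‖Complex.exp ((s * component y α : ℝ) * Complex.I) - 1‖ ^ 2 := by
  have hle_one : |s * component y α| ≤ 1 := by
    rw [abs_mul, abs_of_nonneg hs]
    exact (mul_le_mul_of_nonneg_left (abs_component_le y α) hs).trans hy
  have hsq := pow_le_pow_left₀ (by positivity) (half_abs_le_norm_exp_sub_one hle_one) 2
  rw [div_pow, sq_abs, mul_pow] at hsq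
  linarith

lemma sq_mul_l2_sq_le_translationDisp {z x : ℂ} (hz : ‖z‖ = 1) (hs : 0 ≤ s) (hx : s * ‖x‖ ≤ 1) :
    (s * ‖x‖) ^ 2 * z.im ^ 2 * l2 f ^ 2 ≤
      8 * (translationDisp s f x ^ 2 + translationDisp s f (z * x) ^ 2) := by
  have hzx : s * ‖z * x‖ ≤ 1 := by rwa [norm_mul, hz, one_mul]
  rw [translationDisp_sq, translationDisp_sq, l2_sq, ← integral_const_mul,
    ← integral_add (integrable_of_continuous_circle (by fun_prop))
      (integrable_of_continuous_circle (by fun_prop)), ← integral_const_mul]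
  refine integral_mono (integrable_of_continuous_circle (by fun_prop))
    (integrable_of_continuous_circle (by fun_prop)) fun α => ?_
  dsimp only
  rw [← add_mul, ← mul_assoc]
  refine mul_le_mul_of_nonneg_right ?_ (sq_nonneg _)
  have hdirections := mul_le_mul_of_nonneg_left (sq_im_mul_sq_norm_le hz x α) (sq_nonneg s)
  linarith [sq_mul_le_norm_exp_component hs hx α, sq_mul_le_norm_exp_component hs hzx α]

end Displacement

section SpectralGap

/-- A random walk whose steps, taken from the finite set `S` with weights `w`, are centred and not
all rotations about the origin, and which can step by `g₀` and by its inverse, where the double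
rotation `z` of `g₀` is arithmetically generic: `B z ^ 2 = A z - B` with `A` and `B ≥ 2` coprime. -/
structure IsGenericWalk (S : Finset rigidMotions) (w : rigidMotions → ℝ) (g₀ : rigidMotions) :
    Prop where
  pos : ∀ g ∈ S, 0 < w g
  sum_eq_one : ∑ g ∈ S, w g = 1
  drift_eq_zero : ∑ g ∈ S, (w g : ℂ) * trans g = 0
  mem : g₀ ∈ S
  inv_mem : g₀⁻¹ ∈ S
  exists_relation : ∃ A B : ℤ, 2 ≤ B ∧ IsCoprime A B ∧
    (B : ℂ) * rot (g₀ * g₀) ^ 2 = A * rot (g₀ * g₀) - B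
  im_ne_zero : (rot (g₀ * g₀)).im ≠ 0
  exists_trans_ne_zero : ∃ g ∈ S, trans g ≠ 0

variable {S : Finset rigidMotions} {w : rigidMotions → ℝ} {g₀ : rigidMotions}

lemma IsGenericWalk.rot_sq_ne_one (H : IsGenericWalk S w g₀) : rot g₀ ^ 2 ≠ 1 := fun h =>
  H.im_ne_zero (by rw [rot_mul, ← sq, h, Complex.one_im])

lemma IsGenericWalk.exists_weight_lower_bound (H : IsGenericWalk S w g₀) :
    ∃ m : ℝ, 0 < m ∧ ∀ g ∈ S, m ≤ w g := by
  obtain ⟨g, hg, hmin⟩ := S.exists_min_image w ⟨g₀, H.mem⟩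
  exact ⟨w g, H.pos g hg, hmin⟩

section Contraction

variable {h k : rigidMotions} {A B : ℤ} {s δ : ℝ} {f : C(𝕋, ℂ)} {n : ℕ}

lemma translationDisp_pow_div_pow_mul_le (him : (rot h).im ≠ 0) (hB : 0 < B) (hAB : IsCoprime A B)
    (hrel : (B : ℂ) * rot h ^ 2 = A * rot h - B) (hδh : disp s f h ≤ δ) (hδk : disp s f k ≤ δ) :
    translationDisp s f (rot h ^ n / (B : ℂ) ^ n * commutatorTrans h k) ≤
      24 * B * (1 + 2 / |(rot h).im|) * (n + 1) * δ := by
  have _ : (0 : ℝ) < B := by exact_mod_cast hB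
  have hcomm : translationDisp s f (commutatorTrans h k) ≤ 4 * δ :=
    (translationDisp_commutator_le h k).trans (by linarith)
  have hrot (y : ℂ) : translationDisp s f (rot h * y) ≤ translationDisp s f y + 2 * δ :=
    (translationDisp_rot_mul_le h y).trans (by linarith)
  calc translationDisp s f (rot h ^ n / (B : ℂ) ^ n * commutatorTrans h k)
      ≤ 4 * B * (1 + 2 / |(rot h).im|) * (n + 1) *
          (translationDisp s f (commutatorTrans h k) + 2 * δ) :=
        map_pow_div_pow_smul_le hrot (norm_rot h) him hB hAB hrel (commutatorTrans h k) n
    _ ≤ 4 * B * (1 + 2 / |(rot h).im|) * (n + 1) * (4 * δ + 2 * δ) := by gcongr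
    _ = 24 * B * (1 + 2 / |(rot h).im|) * (n + 1) * δ := by ring

lemma sq_mul_l2_sq_le_disp (him : (rot h).im ≠ 0) (hB : 0 < B) (hAB : IsCoprime A B)
    (hrel : (B : ℂ) * rot h ^ 2 = A * rot h - B) (hs : 0 ≤ s)
    (hsn : s * ‖commutatorTrans h k‖ ≤ (B : ℝ) ^ n) (hδh : disp s f h ≤ δ)
    (hδk : disp s f k ≤ δ) :
    (s * ‖commutatorTrans h k‖ / (B : ℝ) ^ n) ^ 2 * (rot h).im ^ 2 * l2 f ^ 2 ≤
      40 * (24 * B * (1 + 2 / |(rot h).im|) * (n + 1) * δ) ^ 2 := by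
  set x : ℂ := rot h ^ n / (B : ℂ) ^ n * commutatorTrans h k with hx
  set M : ℝ := 24 * B * (1 + 2 / |(rot h).im|) * (n + 1)
  have hB' : (1 : ℝ) ≤ B := by exact_mod_cast hB
  have hδ : 0 ≤ δ := (disp_nonneg h).trans hδh
  have hnorm_x : s * ‖x‖ = s * ‖commutatorTrans h k‖ / (B : ℝ) ^ n := by
    rw [hx, norm_mul, norm_div, norm_pow, norm_pow, norm_rot, one_pow, Complex.norm_intCast,
      abs_of_pos (by linarith)]
    ring
  have hM_ge : 2 ≤ M := by
    have := one_le_mul_of_one_le_of_one_le (one_le_mul_of_one_le_of_one_le hB'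
      (le_add_of_nonneg_right (by positivity : 0 ≤ 2 / |(rot h).im|)))
      (le_add_of_nonneg_left (Nat.cast_nonneg n) : (1 : ℝ) ≤ n + 1)
    linarith
  have hdisp_x : translationDisp s f x ≤ M * δ :=
    translationDisp_pow_div_pow_mul_le him hB hAB hrel hδh hδk
  have hdisp_zx : translationDisp s f (rot h * x) ≤ 2 * (M * δ) := by
    linarith [translationDisp_rot_mul_le (s := s) (f := f) h x,
      mul_le_mul_of_nonneg_right hM_ge hδ]
  have hdirections := sq_mul_l2_sq_le_translationDisp (f := f) (x := x) (norm_rot h) hs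
    (by rw [hnorm_x]; exact div_le_one_of_le₀ hsn (by positivity))
  rw [hnorm_x] at hdirections
  linarith [pow_le_pow_left₀ (apply_nonneg _ _) hdisp_x 2,
    pow_le_pow_left₀ (apply_nonneg _ _) hdisp_zx 2]

end Contraction

lemma IsGenericWalk.exists_gap_at_scale (H : IsGenericWalk S w g₀) :
    ∃ c > 0, ∃ V > 0, ∃ B : ℝ, 2 ≤ B ∧ ∀ (s : ℝ) (n : ℕ) (f : C(𝕋, ℂ)), 0 ≤ s → s * V ≤ B ^ n →
      c * (s * V / B ^ n) ^ 2 / (n + 1) ^ 2 * l2 f ^ 2 ≤ l2 f ^ 2 - l2 (avg s S w f) ^ 2 := by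
  obtain ⟨m, hm, hmw⟩ := H.exists_weight_lower_bound
  obtain ⟨A, B, hB, hAB, hrel⟩ := H.exists_relation
  obtain ⟨a, ha, b, hb, hv⟩ := exists_commutatorTrans_ne_zero H.pos H.sum_eq_one H.drift_eq_zero
    H.mem H.inv_mem H.rot_sq_ne_one H.exists_trans_ne_zero
  have him := H.im_ne_zero
  set h := g₀ * g₀
  have hB' : (2 : ℝ) ≤ B := by exact_mod_cast hB
  set K : ℝ := 24 * B * (1 + 2 / |(rot h).im|) with hK
  have hK_pos : 0 < K := by positivity
  refine ⟨m ^ 2 * (rot h).im ^ 2 / (80 * K ^ 2), by positivity, ‖commutatorTrans h (a⁻¹ * b)‖,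
    norm_pos_iff.mpr hv, B, hB', fun s n f hs hsn => ?_⟩
  set E := l2 f ^ 2 - l2 (avg s S w f) ^ 2
  have hdisp : ∀ g ∈ S, ∀ g' ∈ S, disp s f (g⁻¹ * g') ≤ √(2 * E) / m := fun g hg g' hg' => by
    rw [le_div_iff₀' hm]
    exact disp_inv_mul_le hm hmw H.sum_eq_one hg hg'
  have hdisp_h : disp s f h ≤ √(2 * E) / m := by
    simpa only [inv_inv] using hdisp g₀⁻¹ H.inv_mem g₀ H.mem
  have hbound := sq_mul_l2_sq_le_disp him (by omega) hAB hrel hs hsn hdisp_h (hdisp a ha b hb)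
  have hE_nonneg : 0 ≤ 2 * E :=
    (mul_nonneg (mul_nonneg (H.pos _ H.mem).le (H.pos _ H.mem).le) (sq_nonneg _)).trans
      (l2_circleRep_sub_circleRep_le (s := s) H.pos H.sum_eq_one f H.mem H.mem)
  rw [← hK, mul_pow (K * _), div_pow √_, Real.sq_sqrt hE_nonneg] at hbound
  calc m ^ 2 * (rot h).im ^ 2 / (80 * K ^ 2) *
        (s * ‖commutatorTrans h (a⁻¹ * b)‖ / (B : ℝ) ^ n) ^ 2 / (n + 1) ^ 2 * l2 f ^ 2
      = m ^ 2 / (80 * K ^ 2 * (n + 1) ^ 2) * ((s * ‖commutatorTrans h (a⁻¹ * b)‖ /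
          (B : ℝ) ^ n) ^ 2 * (rot h).im ^ 2 * l2 f ^ 2) := by field_simp
    _ ≤ m ^ 2 / (80 * K ^ 2 * (n + 1) ^ 2) * (40 * ((K * (n + 1)) ^ 2 * (2 * E / m ^ 2))) := by
        gcongr
    _ = E := by
        field_simp
        ring

lemma le_exp_mul_of_mul_sq_le {x y t : ℝ} (hx : 0 ≤ x) (h : t * x ^ 2 ≤ x ^ 2 - y ^ 2) :
    y ≤ Real.exp (-(t / 2)) * x := by
  refine le_of_sq_le_sq ?_ (by positivity)
  have hexp : Real.exp (-(t / 2)) ^ 2 = Real.exp (-t) := by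
    rw [← Real.exp_nat_mul]
    congr 1
    push_cast
    ring
  rw [mul_pow, hexp]
  nlinarith [Real.one_sub_le_exp_neg t, sq_nonneg x]

lemma IsGenericWalk.exists_low_frequency_gap (H : IsGenericWalk S w g₀) :
    ∃ c > 0, ∃ s₀ > 0, s₀ ≤ 1 ∧ ∀ s : ℝ, 0 ≤ s → s ≤ s₀ → ∀ f : C(𝕋, ℂ),
      l2 (avg s S w f) ≤ Real.exp (-(c * s ^ 2)) * l2 f := by
  obtain ⟨c, hc, V, hV, B, -, hgap⟩ := H.exists_gap_at_scale
  refine ⟨c * V ^ 2 / 2, by positivity, min 1 (1 / V), by positivity, min_le_left _ _,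
    fun s hs hs₀ f => ?_⟩
  have hsV : s * V ≤ B ^ 0 := by
    rw [pow_zero, ← le_div_iff₀ hV]
    exact hs₀.trans (min_le_right _ _)
  refine (le_exp_mul_of_mul_sq_le (apply_nonneg l2 f) (hgap s 0 f hs hsV)).trans_eq ?_
  congr 3
  simp only [pow_zero, div_one, Nat.cast_zero, zero_add, one_pow]
  ring

lemma natCast_le_two_mul_of_pow_le {B x : ℝ} (hB : 2 ≤ B) {n : ℕ} (h : B ^ n ≤ x) :
    (n : ℝ) ≤ 2 * Real.log x := by
  have hlog : (n : ℝ) * Real.log 2 ≤ Real.log x := by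
    rw [← Real.log_pow]
    exact Real.log_le_log (by positivity) ((pow_le_pow_left₀ zero_le_two hB n).trans h)
  nlinarith [Real.log_two_gt_d9, n.cast_nonneg (α := ℝ)]

lemma exists_scale {s₀ V B : ℝ} (hs₀ : 0 < s₀) (hV : 0 < V) (hB : 2 ≤ B) {s R : ℝ} (hs : s₀ ≤ s)
    (hsR : s ≤ R) (hR : 1 ≤ R) :
    ∃ n : ℕ, s * V ≤ B ^ n ∧ min (s₀ * V) (1 / B) ≤ s * V / B ^ n ∧
      (n + 1 : ℝ) ≤ (2 + 2 * |Real.log V|) * (1 + Real.log R) := by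
  have hlogR : 0 ≤ Real.log R := Real.log_nonneg hR
  rcases le_or_gt (s * V) 1 with h | h
  · refine ⟨0, by simpa using h, ?_, ?_⟩
    · rw [pow_zero, div_one]
      exact (min_le_left _ _).trans (mul_le_mul_of_nonneg_right hs hV.le)
    · simp only [Nat.cast_zero]
      nlinarith [abs_nonneg (Real.log V)]
  · obtain ⟨n, hn, hn'⟩ := exists_nat_pow_near h.le (show 1 < B by linarith)
    refine ⟨n + 1, hn'.le, (min_le_right _ _).trans ?_, ?_⟩
    · rw [pow_succ, div_le_div_iff₀ (by linarith) (by positivity)]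
      nlinarith
    · have hlog := natCast_le_two_mul_of_pow_le hB
        (hn.trans (mul_le_mul_of_nonneg_right hsR hV.le))
      rw [Real.log_mul (by linarith) hV.ne'] at hlog
      push_cast
      nlinarith [le_abs_self (Real.log V), mul_nonneg (abs_nonneg (Real.log V)) hlogR]

lemma IsGenericWalk.exists_high_frequency_gap (H : IsGenericWalk S w g₀) {s₀ : ℝ}
    (hs₀ : 0 < s₀) : ∃ c > 0, ∀ R s : ℝ, s₀ ≤ s → s ≤ R → 1 ≤ R → ∀ f : C(𝕋, ℂ),
      l2 (avg s S w f) ≤ Real.exp (-(c / (1 + Real.log R) ^ 2)) * l2 f := by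
  obtain ⟨c, hc, V, hV, B, hB, hgap⟩ := H.exists_gap_at_scale
  set D : ℝ := 2 + 2 * |Real.log V|
  have _ : 0 < B := by linarith
  refine ⟨c * (min (s₀ * V) (1 / B)) ^ 2 / D ^ 2 / 2, by positivity, fun R s hs hsR hR f => ?_⟩
  obtain ⟨n, hn, hscale, hn_log⟩ := exists_scale hs₀ hV hB hs hsR hR
  refine (le_exp_mul_of_mul_sq_le (apply_nonneg l2 f)
    (hgap s n f (hs₀.le.trans hs) hn)).trans (mul_le_mul_of_nonneg_right
      (Real.exp_le_exp.mpr (neg_le_neg ?_)) (apply_nonneg l2 f))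
  have _ : 0 < 1 + Real.log R := by linarith [Real.log_nonneg hR]
  calc c * (min (s₀ * V) (1 / B)) ^ 2 / D ^ 2 / 2 / (1 + Real.log R) ^ 2
      = c * (min (s₀ * V) (1 / B)) ^ 2 / (D * (1 + Real.log R)) ^ 2 / 2 := by field_simp
    _ ≤ c * (s * V / B ^ n) ^ 2 / (n + 1) ^ 2 / 2 := by gcongr

end SpectralGap

section LowFrequency

lemma norm_exp_sub_taylor_two_le (t : ℝ) :
    ‖Complex.exp (t * Complex.I) - (1 + t * Complex.I - t ^ 2 / 2)‖ ≤ |t| ^ 3 * Real.exp |t| := by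
  have htaylor := Complex.norm_exp_sub_sum_le_norm_mul_exp (t * Complex.I) 3
  simp only [Finset.sum_range_succ, Finset.sum_range_zero, norm_mul, Complex.norm_real,
    Complex.norm_I, mul_one, mul_pow, Complex.I_sq, Real.norm_eq_abs] at htaylor
  convert htaylor using 2
  norm_num
  ring

lemma norm_exp_mul_I_sub_one_le (t : ℝ) : ‖Complex.exp (t * Complex.I) - 1‖ ≤ |t| := by
  rw [mul_comm]
  exact Real.norm_exp_I_mul_ofReal_sub_one_le

lemma norm_sum_ofReal_mul_le {ι : Type*} {S : Finset ι} {w : ι → ℝ} (hw : ∀ i ∈ S, 0 ≤ w i)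
    (hsum : ∑ i ∈ S, w i = 1) {F : ι → ℂ} {c : ℝ} (hF : ∀ i ∈ S, ‖F i‖ ≤ c) :
    ‖∑ i ∈ S, (w i : ℂ) * F i‖ ≤ c :=
  calc ‖∑ i ∈ S, (w i : ℂ) * F i‖ ≤ ∑ i ∈ S, w i * c := norm_sum_le_of_le _ fun i hi => by
        rw [norm_mul, Complex.norm_real, Real.norm_of_nonneg (hw i hi)]
        exact mul_le_mul_of_nonneg_left (hF i hi) (hw i hi)
    _ = c := by rw [← Finset.sum_mul, hsum, one_mul]

lemma norm_sum_exp_sub_expansion_le {ι : Type*} {S : Finset ι} {w c : ι → ℝ} {q : ι → ℂ}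
    (hw : ∀ i ∈ S, 0 ≤ w i) (hsum : ∑ i ∈ S, w i = 1) (hmean : ∑ i ∈ S, w i * c i = 0)
    {M Q : ℝ} (hc : ∀ i ∈ S, |c i| ≤ M) (hq : ∀ i ∈ S, ‖q i‖ ≤ Q) {s : ℝ} (hs : 0 ≤ s)
    (hs₁ : s ≤ 1) :
    ‖∑ i ∈ S, (w i : ℂ) * (Complex.exp ((s * c i : ℝ) * Complex.I) * (1 + s ^ 2 * q i)) -
      (1 + s ^ 2 * (∑ i ∈ S, (w i : ℂ) * q i - (∑ i ∈ S, w i * c i ^ 2 / 2 : ℝ)))‖ ≤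
      (M ^ 3 * Real.exp M + M * Q) * s ^ 3 := by
  have hexpansion : 1 + (s : ℂ) ^ 2 * (∑ i ∈ S, (w i : ℂ) * q i -
      (∑ i ∈ S, w i * c i ^ 2 / 2 : ℝ)) = ∑ i ∈ S, (w i : ℂ) *
        (1 + (s * c i : ℝ) * Complex.I - (s * c i : ℝ) ^ 2 / 2 + s ^ 2 * q i) := by
    have hsum' : ∑ i ∈ S, (w i : ℂ) = 1 := by exact_mod_cast hsum
    have hmean' : ∑ i ∈ S, (w i : ℂ) * c i = 0 := by exact_mod_cast hmean
    calc _ = ∑ i ∈ S, (w i : ℂ) + s * Complex.I * ∑ i ∈ S, (w i : ℂ) * c i +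
          s ^ 2 * (∑ i ∈ S, (w i : ℂ) * q i - (∑ i ∈ S, w i * c i ^ 2 / 2 : ℝ)) := by
          rw [hsum', hmean', mul_zero, add_zero]
      _ = _ := by
          push_cast
          rw [← Finset.sum_sub_distrib, Finset.mul_sum, Finset.mul_sum, ← Finset.sum_add_distrib,
            ← Finset.sum_add_distrib]
          exact Finset.sum_congr rfl fun i _ => by ring
  rw [hexpansion, ← Finset.sum_sub_distrib]
  simp only [← mul_sub]
  refine norm_sum_ofReal_mul_le hw hsum fun i hi => ?_
  have hM : 0 ≤ M := (abs_nonneg _).trans (hc i hi)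
  have hsc : |s * c i| ≤ s * M := by
    rw [abs_mul, abs_of_nonneg hs]
    exact mul_le_mul_of_nonneg_left (hc i hi) hs
  have hsM : s * M ≤ M := mul_le_of_le_one_left hM hs₁
  set e := Complex.exp ((s * c i : ℝ) * Complex.I)
  set T := 1 + (s * c i : ℝ) * Complex.I - ((s * c i : ℝ) : ℂ) ^ 2 / 2
  calc ‖e * (1 + s ^ 2 * q i) - (T + s ^ 2 * q i)‖
      = ‖(e - T) + (e - 1) * (s ^ 2 * q i)‖ := by congr 1; ring
    _ ≤ (s * M) ^ 3 * Real.exp M + s * M * (s ^ 2 * Q) := by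
        refine norm_add_le_of_le ((norm_exp_sub_taylor_two_le _).trans ?_) ?_
        · gcongr
          exact hsc.trans hsM
        · rw [norm_mul, norm_mul, norm_pow, Complex.norm_real, Real.norm_of_nonneg hs]
          gcongr
          exacts [(norm_exp_mul_I_sub_one_le _).trans hsc, hq i hi]
    _ = (M ^ 3 * Real.exp M + M * Q) * s ^ 3 := by ring

lemma abs_exp_neg_sub_one_sub_le {x : ℝ} (hx : 0 ≤ x) : |Real.exp (-x) - (1 - x)| ≤ x ^ 2 := by
  rw [abs_of_nonneg (sub_nonneg.mpr (Real.one_sub_le_exp_neg x))]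
  have hinv : Real.exp (-x) ≤ (1 + x)⁻¹ := by
    rw [Real.exp_neg]
    exact inv_anti₀ (by linarith) (by linarith [Real.add_one_le_exp x])
  have hgeom : (1 + x)⁻¹ ≤ 1 - x + x ^ 2 := by
    rw [inv_le_iff_one_le_mul₀ (by linarith)]
    nlinarith [pow_nonneg hx 3]
  linarith

lemma norm_expansion_sub_exp_mul_le {v s : ℝ} (hv : 0 ≤ v) (hs : 0 ≤ s) (hs₁ : s ≤ 1) {q : ℂ}
    {Q : ℝ} (hq : ‖q‖ ≤ Q) :
    ‖1 + s ^ 2 * (q - v) - Real.exp (-(v * s ^ 2)) * (1 + s ^ 2 * q)‖ ≤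
      (v * Q + v ^ 2 * (1 + Q)) * s ^ 3 := by
  have hE : ‖(Real.exp (-(v * s ^ 2)) : ℂ) - (1 - v * s ^ 2)‖ ≤ (v * s ^ 2) ^ 2 := by
    exact_mod_cast abs_exp_neg_sub_one_sub_le (mul_nonneg hv (sq_nonneg s))
  set E : ℂ := (Real.exp (-(v * s ^ 2)) : ℂ)
  have hs_sq : s ^ 2 ≤ 1 := pow_le_one₀ hs hs₁
  have hQ : 0 ≤ Q := (norm_nonneg q).trans hq
  have hnorm_s : ‖(s : ℂ)‖ = s := by rw [Complex.norm_real, Real.norm_of_nonneg hs]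
  have hnorm_v : ‖(v : ℂ)‖ = v := by rw [Complex.norm_real, Real.norm_of_nonneg hv]
  calc ‖1 + s ^ 2 * (q - v) - E * (1 + s ^ 2 * q)‖
      = ‖s ^ 4 * v * q - (E - (1 - v * s ^ 2)) * (1 + s ^ 2 * q)‖ := by congr 1; ring
    _ ≤ s ^ 4 * v * Q + (v * s ^ 2) ^ 2 * (1 + Q) := by
        refine norm_sub_le_of_le ?_ ?_
        · rw [norm_mul, norm_mul, norm_pow, hnorm_s, hnorm_v]
          gcongr
        · rw [norm_mul]
          gcongr
          refine norm_add_le_of_le norm_one.le ?_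
          rw [norm_mul, norm_pow, hnorm_s]
          exact (mul_le_of_le_one_left (norm_nonneg q) hs_sq).trans hq
    _ = (v * Q + v ^ 2 * (1 + Q)) * s ^ 4 := by ring
    _ ≤ (v * Q + v ^ 2 * (1 + Q)) * s ^ 3 := by
        have := pow_le_pow_of_le_one hs hs₁ (show 3 ≤ 4 by norm_num)
        gcongr

/-- The trigonometric polynomial `Re (a e^{2iα})`, the second-order correction to the constant
function `1` as an approximate eigenfunction of the averaging operators. -/
def corrector (a : ℂ) : C(𝕋, ℂ) := ⟨fun α => ((a * phase α ^ 2).re : ℝ), by fun_prop⟩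

lemma corrector_apply (a : ℂ) (α : 𝕋) : corrector a α = ((a * phase α ^ 2).re : ℝ) := rfl

lemma norm_corrector_le (a : ℂ) (α : 𝕋) : ‖corrector a α‖ ≤ ‖a‖ := by
  rw [corrector_apply, Complex.norm_real]
  exact (Complex.abs_re_le_norm _).trans (by simp)

lemma corrector_sub_rotAngle (a : ℂ) (g : rigidMotions) (α : 𝕋) :
    corrector a (α - rotAngle g) = ((a * (rot g)⁻¹ ^ 2 * phase α ^ 2).re : ℝ) := by
  rw [corrector_apply, sub_eq_add_neg, phase_add, phase_neg, phase_rotAngle]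
  congr 2
  ring

lemma component_sq (v : ℂ) (α : 𝕋) :
    component v α ^ 2 = ‖v‖ ^ 2 / 2 + ((starRingEnd ℂ) v ^ 2 * phase α ^ 2).re / 2 := by
  have hnorm : ‖v‖ = ‖phase α * (starRingEnd ℂ) v‖ := by simp
  rw [component_eq_re, ← mul_pow, mul_comm ((starRingEnd ℂ) v), hnorm]
  generalize phase α * (starRingEnd ℂ) v = p
  rw [← Complex.normSq_eq_norm_sq, Complex.normSq_apply, sq p, Complex.mul_re]
  ring

lemma sum_mul_re {ι : Type*} (S : Finset ι) (w : ι → ℝ) (F : ι → ℂ) :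
    ∑ i ∈ S, w i * (F i).re = (∑ i ∈ S, (w i : ℂ) * F i).re := by
  simp only [Complex.re_sum, Complex.re_ofReal_mul]

variable {S : Finset rigidMotions} {w : rigidMotions → ℝ} {g₀ : rigidMotions}

/-- The variance parameter `σ² = ½ ∑ w g |g(0)|²`. -/
def sigmaSq (S : Finset rigidMotions) (w : rigidMotions → ℝ) : ℝ :=
  1 / 2 * ∑ g ∈ S, w g * ‖trans g‖ ^ 2

lemma IsGenericWalk.sigmaSq_pos (H : IsGenericWalk S w g₀) : 0 < sigmaSq S w := by
  obtain ⟨g, hg, hne⟩ := H.exists_trans_ne_zero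
  refine mul_pos one_half_pos (Finset.sum_pos'
    (fun g hg => mul_nonneg (H.pos g hg).le (sq_nonneg _)) ⟨g, hg, mul_pos (H.pos g hg) ?_⟩)
  have := norm_pos_iff.mpr hne
  positivity

lemma IsGenericWalk.sum_inv_rot_sq_ne_one (H : IsGenericWalk S w g₀) :
    ∑ g ∈ S, (w g : ℂ) * (rot g)⁻¹ ^ 2 ≠ 1 :=
  sum_mul_ne_one_of_norm_eq_one H.pos H.sum_eq_one (fun g _ => by simp) H.mem
    (by rw [inv_pow, Ne, inv_eq_one]; exact H.rot_sq_ne_one)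

lemma sum_component_sq_div_two (α : 𝕋) : ∑ g ∈ S, w g * component (trans g) α ^ 2 / 2 =
    sigmaSq S w / 2 +
      ((∑ g ∈ S, (w g : ℂ) * (starRingEnd ℂ) (trans g) ^ 2) * phase α ^ 2).re / 4 := by
  simp only [Finset.sum_mul, mul_assoc]
  rw [← sum_mul_re, sigmaSq, Finset.mul_sum, Finset.sum_div, Finset.sum_div,
    ← Finset.sum_add_distrib]
  refine Finset.sum_congr rfl fun g _ => ?_
  rw [component_sq]
  ring

-- The corrector solves a Poisson equation that cancels the anisotropy of the second-order term.
lemma IsGenericWalk.exists_corrector (H : IsGenericWalk S w g₀) : ∃ a : ℂ, ∀ α : 𝕋,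
    ∑ g ∈ S, (w g : ℂ) * corrector a (α - rotAngle g) -
        (∑ g ∈ S, w g * component (trans g) α ^ 2 / 2 : ℝ) =
      corrector a α - (sigmaSq S w / 2 : ℝ) := by
  set l := ∑ g ∈ S, (w g : ℂ) * (rot g)⁻¹ ^ 2 with hl
  have hl_ne : l - 1 ≠ 0 := sub_ne_zero.mpr H.sum_inv_rot_sq_ne_one
  set m := ∑ g ∈ S, (w g : ℂ) * (starRingEnd ℂ) (trans g) ^ 2 with hm
  refine ⟨m / (4 * (l - 1)), fun α => ?_⟩
  set a := m / (4 * (l - 1)) with ha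
  have hshift : ∑ g ∈ S, w g * (a * (rot g)⁻¹ ^ 2 * phase α ^ 2).re = (a * l * phase α ^ 2).re := by
    rw [sum_mul_re, hl, Finset.mul_sum, Finset.sum_mul]
    exact congrArg Complex.re (Finset.sum_congr rfl fun g _ => by ring)
  have hpoisson : (a * l * phase α ^ 2).re =
      (a * phase α ^ 2).re + (m * phase α ^ 2).re / 4 := by
    have : a * l * phase α ^ 2 = a * phase α ^ 2 + m * phase α ^ 2 / 4 := by
      rw [ha]
      field_simp
      ring
    rw [this, Complex.add_re, Complex.div_ofNat_re]
  simp only [corrector_sub_rotAngle]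
  rw [corrector_apply, sum_component_sq_div_two, ← hm]
  norm_cast
  rw [hshift, hpoisson]
  ring

lemma IsGenericWalk.sum_component_eq_zero (H : IsGenericWalk S w g₀) (α : 𝕋) :
    ∑ g ∈ S, w g * component (trans g) α = 0 := by
  have hdrift : ∑ g ∈ S, w g • trans g = 0 := by
    simpa only [Complex.real_smul] using H.drift_eq_zero
  simpa only [component, sum_inner, real_inner_smul_left, inner_zero_left] using
    congrArg (inner ℝ · (phase α)) hdrift

lemma IsGenericWalk.exists_approx_eigenvector (H : IsGenericWalk S w g₀) :
    ∃ a : ℂ, ∃ C > 0, ∀ s : ℝ, 0 ≤ s → s ≤ 1 → ∀ α : 𝕋,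
      ‖avg s S w (1 + ((s ^ 2 : ℝ) : ℂ) • corrector a) α -
        (Real.exp (-(sigmaSq S w / 2 * s ^ 2)) : ℂ) *
          (1 + ((s ^ 2 : ℝ) : ℂ) • corrector a : C(𝕋, ℂ)) α‖ ≤ C * s ^ 3 := by
  obtain ⟨a, ha⟩ := H.exists_corrector
  obtain ⟨M, hM⟩ := (S.finite_toSet.image fun g => ‖trans g‖).bddAbove
  replace hM : ∀ g ∈ S, ‖trans g‖ ≤ M := fun g hg => hM ⟨g, hg, rfl⟩
  have hM_nonneg : 0 ≤ M := (norm_nonneg _).trans (hM g₀ H.mem)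
  set v := sigmaSq S w / 2
  have hv : 0 < v := half_pos H.sigmaSq_pos
  refine ⟨a, M ^ 3 * Real.exp M + M * ‖a‖ + (v * ‖a‖ + v ^ 2 * (1 + ‖a‖)), by positivity,
    fun s hs hs₁ α => ?_⟩
  have havg : avg s S w (1 + ((s ^ 2 : ℝ) : ℂ) • corrector a) α = ∑ g ∈ S, (w g : ℂ) *
      (Complex.exp ((s * component (trans g) α : ℝ) * Complex.I) *
        (1 + s ^ 2 * corrector a (α - rotAngle g))) := by
    rw [avg_apply]
    refine Finset.sum_congr rfl fun g _ => ?_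
    rw [circleRep_apply]
    simp
  have hvalue : (1 + ((s ^ 2 : ℝ) : ℂ) • corrector a : C(𝕋, ℂ)) α = 1 + s ^ 2 * corrector a α := by
    simp
  have hexpansion := norm_sum_exp_sub_expansion_le (fun g hg => (H.pos g hg).le) H.sum_eq_one
    (H.sum_component_eq_zero α) (fun g hg => (abs_component_le _ α).trans (hM g hg))
    (fun g _ => norm_corrector_le a (α - rotAngle g)) hs hs₁
  rw [ha] at hexpansion
  rw [havg, hvalue, add_mul]
  exact (norm_sub_le_norm_sub_add_norm_sub _ _ _).trans
    (add_le_add hexpansion (norm_expansion_sub_exp_mul_le hv.le hs hs₁ (norm_corrector_le a α)))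

end LowFrequency

section Iteration

section ApproximateEigenvector

variable {E : Type*} [AddCommGroup E] [Module ℂ E] {p : Seminorm ℂ E} {T : Module.End ℂ E} {ρ : ℝ}

lemma seminorm_pow_apply_le (hρ : 0 ≤ ρ) (hT : ∀ x, p (T x) ≤ ρ * p x) (n : ℕ) (x : E) :
    p ((T ^ n) x) ≤ ρ ^ n * p x := by
  induction n with
  | zero => simp
  | succ n ih =>
    rw [pow_succ', Module.End.mul_apply, pow_succ', mul_assoc]
    exact (hT _).trans (mul_le_mul_of_nonneg_left ih hρ)

variable {l e : ℝ}

lemma seminorm_pow_apply_sub_smul_le (hl : 0 ≤ l) (hlρ : l ≤ ρ) (hT : ∀ x, p (T x) ≤ ρ * p x)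
    {x : E} (hx : p (T x - (l : ℂ) • x) ≤ ρ * e) (n : ℕ) :
    p ((T ^ n) x - ((l ^ n : ℝ) : ℂ) • x) ≤ ρ ^ n * (n * e) := by
  have hρ : 0 ≤ ρ := hl.trans hlρ
  induction n with
  | zero => simp
  | succ n ih =>
    have hsplit : (T ^ (n + 1)) x - ((l ^ (n + 1) : ℝ) : ℂ) • x =
        T ((T ^ n) x - ((l ^ n : ℝ) : ℂ) • x) + ((l ^ n : ℝ) : ℂ) • (T x - (l : ℂ) • x) := by
      rw [pow_succ', Module.End.mul_apply, map_sub, map_smul, smul_sub, smul_smul, pow_succ]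
      push_cast
      abel
    have hlast : p (((l ^ n : ℝ) : ℂ) • (T x - (l : ℂ) • x)) ≤ ρ ^ n * (ρ * e) := by
      rw [map_smul_eq_mul, Complex.norm_real, Real.norm_of_nonneg (pow_nonneg hl n)]
      exact mul_le_mul (pow_le_pow_left₀ hl hlρ n) hx (apply_nonneg _ _) (pow_nonneg hρ n)
    calc p ((T ^ (n + 1)) x - ((l ^ (n + 1) : ℝ) : ℂ) • x)
        ≤ p (T ((T ^ n) x - ((l ^ n : ℝ) : ℂ) • x)) + ρ ^ n * (ρ * e) := by
          rw [hsplit]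
          exact (map_add_le_add p _ _).trans (add_le_add_right hlast _)
      _ ≤ ρ * (ρ ^ n * (n * e)) + ρ ^ n * (ρ * e) :=
          add_le_add_left ((hT _).trans (mul_le_mul_of_nonneg_left ih hρ)) _
      _ = ρ ^ (n + 1) * ((n + 1 : ℕ) * e) := by push_cast; ring

lemma seminorm_pow_apply_sub_smul_le_of_perturbation (hl : 0 ≤ l) (hlρ : l ≤ ρ)
    (hT : ∀ x, p (T x) ≤ ρ * p x) {x u : E}
    (hxu : p (T (x + u) - (l : ℂ) • (x + u)) ≤ ρ * e) (n : ℕ) :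
    p ((T ^ n) x - ((l ^ n : ℝ) : ℂ) • x) ≤ ρ ^ n * (n * e + 2 * p u) := by
  have hρ : 0 ≤ ρ := hl.trans hlρ
  have hsplit : (T ^ n) x - ((l ^ n : ℝ) : ℂ) • x =
      ((T ^ n) (x + u) - ((l ^ n : ℝ) : ℂ) • (x + u)) - (T ^ n) u + ((l ^ n : ℝ) : ℂ) • u := by
    rw [map_add, smul_add]
    abel
  have hlu : p (((l ^ n : ℝ) : ℂ) • u) ≤ ρ ^ n * p u := by
    rw [map_smul_eq_mul, Complex.norm_real, Real.norm_of_nonneg (pow_nonneg hl n)]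
    exact mul_le_mul_of_nonneg_right (pow_le_pow_left₀ hl hlρ n) (apply_nonneg _ _)
  rw [hsplit]
  linarith [map_add_le_add p ((T ^ n) (x + u) - ((l ^ n : ℝ) : ℂ) • (x + u) - (T ^ n) u)
      (((l ^ n : ℝ) : ℂ) • u),
    map_sub_le_add p ((T ^ n) (x + u) - ((l ^ n : ℝ) : ℂ) • (x + u)) ((T ^ n) u),
    seminorm_pow_apply_sub_smul_le hl hlρ hT hxu n, seminorm_pow_apply_le hρ hT n u]

end ApproximateEigenvector

variable {S : Finset rigidMotions} {w : rigidMotions → ℝ} {g₀ : rigidMotions}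

/-- The difference between the characteristic functions of the walk and of the Gaussian after `n`
steps, on the frequency circle of radius `s`. -/
def charDiff (S : Finset rigidMotions) (w : rigidMotions → ℝ) (n : ℕ) (s : ℝ) : C(𝕋, ℂ) :=
  (avg s S w ^ n) 1 - ((Real.exp (-(sigmaSq S w / 2 * s ^ 2)) ^ n : ℝ) : ℂ) • 1

lemma l2_one_le : l2 1 ≤ 3 := by
  simpa using l2_le_of_norm_le (f := 1) zero_le_one fun α => by simp

lemma l2_charDiff_le_of_avg_le {s ρ : ℝ} (hT : ∀ f, l2 (avg s S w f) ≤ ρ * l2 f)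
    (hρ : Real.exp (-(sigmaSq S w / 2 * s ^ 2)) ≤ ρ) (n : ℕ) :
    l2 (charDiff S w n s) ≤ 6 * ρ ^ n := by
  have hρ_nonneg : 0 ≤ ρ := (Real.exp_pos _).le.trans hρ
  calc l2 (charDiff S w n s)
      ≤ l2 ((avg s S w ^ n) 1) + Real.exp (-(sigmaSq S w / 2 * s ^ 2)) ^ n * l2 1 := by
        refine (map_sub_le_add l2 _ _).trans_eq ?_
        rw [map_smul_eq_mul, Complex.norm_real, Real.norm_of_nonneg (by positivity)]
    _ ≤ ρ ^ n * 3 + ρ ^ n * 3 := by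
        gcongr
        · exact (seminorm_pow_apply_le hρ_nonneg hT n 1).trans (by gcongr; exact l2_one_le)
        · exact l2_one_le
    _ = 6 * ρ ^ n := by ring

lemma IsGenericWalk.l2_avg_le (H : IsGenericWalk S w g₀) (s : ℝ) (f : C(𝕋, ℂ)) :
    l2 (avg s S w f) ≤ l2 f := by
  have hvar := l2_circleRep_sub_circleRep_le (s := s) H.pos H.sum_eq_one f H.mem H.mem
  rw [sub_self, map_zero] at hvar
  exact le_of_sq_le_sq (by linarith) (apply_nonneg l2 f)

lemma IsGenericWalk.l2_charDiff_le (H : IsGenericWalk S w g₀) (n : ℕ) (s : ℝ) :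
    l2 (charDiff S w n s) ≤ 6 := by
  have hσ := H.sigmaSq_pos
  simpa using l2_charDiff_le_of_avg_le (ρ := 1) (by simpa using H.l2_avg_le s)
    (Real.exp_le_one_iff.mpr (neg_nonpos.mpr (by positivity))) n

lemma IsGenericWalk.exists_low_frequency_charDiff_le (H : IsGenericWalk S w g₀) :
    ∃ c > 0, ∃ C > 0, ∃ s₀ > 0, ∀ (n : ℕ) (s : ℝ), 0 ≤ s → s ≤ s₀ →
      l2 (charDiff S w n s) ≤ C * (n * s ^ 3 + s ^ 2) * Real.exp (-(c * n * s ^ 2)) := by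
  obtain ⟨c₁, hc₁, s₀, hs₀, hs₀_le, hgap⟩ := H.exists_low_frequency_gap
  obtain ⟨a, C, hC, heig⟩ := H.exists_approx_eigenvector
  have hσ := H.sigmaSq_pos
  set c := min c₁ (sigmaSq S w / 2)
  have hc : 0 < c := by positivity
  set A := 3 * C * Real.exp c
  refine ⟨c, hc, A + 6 * ‖a‖, by positivity, s₀, hs₀, fun n s hs hss₀ => ?_⟩
  have hs₁ : s ≤ 1 := hss₀.trans hs₀_le
  set ρ := Real.exp (-(c * s ^ 2))
  have hT : ∀ f, l2 (avg s S w f) ≤ ρ * l2 f := fun f => by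
    refine (hgap s hs hss₀ f).trans (mul_le_mul_of_nonneg_right ?_ (apply_nonneg l2 f))
    exact Real.exp_le_exp.mpr (by gcongr; exact min_le_left _ _)
  have hlρ : Real.exp (-(sigmaSq S w / 2 * s ^ 2)) ≤ ρ :=
    Real.exp_le_exp.mpr (by gcongr; exact min_le_right _ _)
  have hρ_lower : 1 ≤ Real.exp c * ρ := by
    rw [← Real.exp_add]
    exact Real.one_le_exp (by nlinarith [pow_le_one₀ hs hs₁ (n := 2)])
  set u : C(𝕋, ℂ) := ((s ^ 2 : ℝ) : ℂ) • corrector a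
  have hu : l2 u ≤ 3 * ‖a‖ * s ^ 2 := by
    rw [map_smul_eq_mul, Complex.norm_real, Real.norm_of_nonneg (sq_nonneg s), mul_comm]
    gcongr
    exact l2_le_of_norm_le (norm_nonneg a) (norm_corrector_le a)
  have happrox : l2 (avg s S w (1 + u) -
      (Real.exp (-(sigmaSq S w / 2 * s ^ 2)) : ℂ) • (1 + u)) ≤ ρ * (A * s ^ 3) :=
    calc _ ≤ 3 * (C * s ^ 3) := l2_le_of_norm_le (by positivity) (heig s hs hs₁)
      _ ≤ Real.exp c * ρ * (3 * (C * s ^ 3)) := le_mul_of_one_le_left (by positivity) hρ_lower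
      _ = ρ * (A * s ^ 3) := by ring
  have hρ_pow : ρ ^ n = Real.exp (-(c * n * s ^ 2)) := by
    rw [← Real.exp_nat_mul]
    congr 1
    ring
  calc l2 (charDiff S w n s) ≤ ρ ^ n * (n * (A * s ^ 3) + 2 * l2 u) :=
        seminorm_pow_apply_sub_smul_le_of_perturbation (Real.exp_pos _).le hlρ hT happrox n
    _ ≤ ρ ^ n * ((A + 6 * ‖a‖) * (n * s ^ 3 + s ^ 2)) := by
        gcongr
        nlinarith [show 0 ≤ A * s ^ 2 by positivity, show 0 ≤ ‖a‖ * (n * s ^ 3) by positivity]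
    _ = _ := by rw [hρ_pow, mul_comm]

lemma IsGenericWalk.exists_high_frequency_charDiff_le (H : IsGenericWalk S w g₀) {s₀ : ℝ}
    (hs₀ : 0 < s₀) : ∃ c > 0, ∀ (n : ℕ) (R s : ℝ), s₀ ≤ s → s ≤ R → 1 ≤ R →
      l2 (charDiff S w n s) ≤ 6 * Real.exp (-(c * n / (1 + Real.log R) ^ 2)) := by
  obtain ⟨c₁, hc₁, hgap⟩ := H.exists_high_frequency_gap hs₀
  have hσ := H.sigmaSq_pos
  set c := min c₁ (sigmaSq S w / 2 * s₀ ^ 2)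
  have hc : 0 < c := by positivity
  refine ⟨c, hc, fun n R s hs hsR hR => ?_⟩
  have hlog : 1 ≤ (1 + Real.log R) ^ 2 := one_le_pow₀ (by linarith [Real.log_nonneg hR])
  set ρ := Real.exp (-(c / (1 + Real.log R) ^ 2))
  have hT : ∀ f, l2 (avg s S w f) ≤ ρ * l2 f := fun f => by
    refine (hgap R s hs hsR hR f).trans (mul_le_mul_of_nonneg_right ?_ (apply_nonneg l2 f))
    exact Real.exp_le_exp.mpr (by gcongr; exact min_le_left _ _)
  have hlρ : Real.exp (-(sigmaSq S w / 2 * s ^ 2)) ≤ ρ := by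
    refine Real.exp_le_exp.mpr (neg_le_neg ?_)
    calc c / (1 + Real.log R) ^ 2 ≤ c := div_le_self hc.le hlog
      _ ≤ sigmaSq S w / 2 * s₀ ^ 2 := min_le_right _ _
      _ ≤ sigmaSq S w / 2 * s ^ 2 := by gcongr
  refine (l2_charDiff_le_of_avg_le hT hlρ n).trans_eq ?_
  rw [← Real.exp_nat_mul]
  ring_nf

lemma IsGenericWalk.exists_l2_charDiff_le (H : IsGenericWalk S w g₀) :
    ∃ c > 0, ∃ C > 0, ∀ (n : ℕ) (R s : ℝ), 1 ≤ R → 0 ≤ s → s ≤ R →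
      l2 (charDiff S w n s) ≤ C * (n * s ^ 3 + s ^ 2) * Real.exp (-(c * n * s ^ 2)) +
        6 * Real.exp (-(c * n / (1 + Real.log R) ^ 2)) := by
  obtain ⟨c₁, hc₁, C, hC, s₀, hs₀, hlow⟩ := H.exists_low_frequency_charDiff_le
  obtain ⟨c₂, hc₂, hhigh⟩ := H.exists_high_frequency_charDiff_le hs₀
  refine ⟨min c₁ c₂, by positivity, C, hC, fun n R s hR hs hsR => ?_⟩
  rcases le_total s s₀ with hss₀ | hss₀
  · refine (hlow n s hs hss₀).trans (le_add_of_le_of_nonneg ?_ (by positivity))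
    gcongr
    exact min_le_left _ _
  · refine (hhigh n R s hss₀ hsR hR).trans (le_add_of_nonneg_of_le (by positivity) ?_)
    gcongr
    exact min_le_right _ _

end Iteration

section Expectation

variable {X Y E : Type*} [NormedAddCommGroup E] [NormedSpace ℝ E]

/-- The expectation of a function under a discrete law. -/
def expect (p : PMF X) (F : X → E) : E := ∑' a, (p a).toReal • F a

lemma expect_pure (a : X) (F : X → E) : expect (PMF.pure a) F = F a := by
  classical
  rw [expect, tsum_eq_single a fun b hb => by simp [PMF.pure_apply, hb]]
  simp

lemma expect_bind [CompleteSpace E] (p : PMF X) (q : X → PMF Y) {F : Y → E} {M : ℝ}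
    (hF : ∀ b, ‖F b‖ ≤ M) : expect (p.bind q) F = expect p fun a => expect (q a) F := by
  have hsummable : Summable fun x : X × Y => (p x.1 * q x.1 x.2).toReal • F x.2 := by
    have hmass : Summable fun x : X × Y => (p x.1 * q x.1 x.2).toReal := by
      apply ENNReal.summable_toReal
      rw [ENNReal.tsum_prod']
      simp [ENNReal.tsum_mul_left, PMF.tsum_coe]
    refine Summable.of_norm_bounded (hmass.mul_right M) fun x => ?_
    rw [norm_smul, Real.norm_of_nonneg ENNReal.toReal_nonneg]
    exact mul_le_mul_of_nonneg_left (hF _) ENNReal.toReal_nonneg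
  calc expect (p.bind q) F = ∑' b, ∑' a, (p a * q a b).toReal • F b := by
        refine tsum_congr fun b => ?_
        have hne : ∀ a, p a * q a b ≠ ⊤ := fun a =>
          ENNReal.mul_ne_top (p.apply_ne_top a) ((q a).apply_ne_top b)
        rw [PMF.bind_apply, ENNReal.tsum_toReal_eq hne, Summable.tsum_smul_const]
        refine ENNReal.summable_toReal ?_
        rw [← PMF.bind_apply]
        exact (p.bind q).apply_ne_top b
    _ = ∑' a, ∑' b, (p a * q a b).toReal • F b :=
        Summable.tsum_comm (f := fun a b => (p a * q a b).toReal • F b) hsummable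
    _ = expect p fun a => expect (q a) F := by
        simp only [expect, ENNReal.toReal_mul, mul_smul, tsum_const_smul'']

lemma expect_map [CompleteSpace E] (p : PMF X) (f : X → Y) {F : Y → E} {M : ℝ}
    (hF : ∀ b, ‖F b‖ ≤ M) : expect (p.map f) F = expect p fun a => F (f a) := by
  simp only [PMF.map, expect_bind p _ hF, Function.comp_apply, expect_pure]

lemma expect_eq_sum {p : PMF X} (hp : p.support.Finite) (F : X → E) :
    expect p F = ∑ a ∈ hp.toFinset, (p a).toReal • F a := by
  refine tsum_eq_sum fun a ha => ?_
  rw [Set.Finite.mem_toFinset, PMF.mem_support_iff, not_not] at ha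
  simp [ha]

lemma sum_toReal_eq_one {p : PMF X} (hp : p.support.Finite) :
    ∑ a ∈ hp.toFinset, (p a).toReal = 1 := by
  have htsum : ∑' a, p a = ∑ a ∈ hp.toFinset, p a :=
    tsum_eq_sum fun a ha => by
      rwa [Set.Finite.mem_toFinset, PMF.mem_support_iff, not_not] at ha
  rw [← ENNReal.toReal_sum fun a _ => p.apply_ne_top a, ← htsum, p.tsum_coe, ENNReal.toReal_one]

lemma map_eq_pure_of_forall {p : PMF X} {f : X → Y} {b : Y} (h : ∀ a ∈ p.support, f a = b) :
    p.map f = PMF.pure b := by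
  rw [PMF.map, ← PMF.bind_const p (PMF.pure b)]
  ext y
  rw [PMF.bind_apply, PMF.bind_apply]
  refine tsum_congr fun a => ?_
  by_cases ha : a ∈ p.support
  · rw [Function.comp_apply, h a ha]
  · rw [(p.apply_eq_zero_iff a).mpr ha, zero_mul, zero_mul]

end Expectation

section WalkLaw

variable {μ : PMF rigidMotions}

lemma norm_circleRep_apply_le (s : ℝ) (g : rigidMotions) (f : C(𝕋, ℂ)) (α : 𝕋) :
    ‖circleRep s g f α‖ ≤ ‖f‖ :=
  (norm_circleRep_apply s g f α).trans_le (f.norm_coe_le_norm _)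

lemma expect_productLaw_circleRep (hfin : μ.support.Finite) (s : ℝ) (α : 𝕋) (n : ℕ)
    (f : C(𝕋, ℂ)) : expect (productLaw μ n) (fun h => circleRep s h f α) =
      (avg s hfin.toFinset (fun g => (μ g).toReal) ^ n) f α := by
  induction n generalizing f with
  | zero => rw [productLaw, expect_pure, map_one, pow_zero]
  | succ n ih =>
    rw [productLaw, expect_bind _ _ (fun h => norm_circleRep_apply_le s h f α), pow_succ,
      Module.End.mul_apply, ← ih]
    congr 1
    ext h
    rw [expect_map _ _ (fun h => norm_circleRep_apply_le s h f α), expect_eq_sum hfin,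
      avg_eq_sum, map_sum, ContinuousMap.sum_apply]
    refine Finset.sum_congr rfl fun g _ => ?_
    rw [map_mul, Module.End.mul_apply, map_smul, ContinuousMap.smul_apply, smul_eq_mul,
      Complex.real_smul]

lemma inner_mul_phase (v : ℂ) (s : ℝ) (α : 𝕋) :
    inner ℝ v (s * phase α) = s * component v α := by
  rw [← Complex.real_smul, inner_smul_right, component]

lemma charFun_walkLaw (hfin : μ.support.Finite) (n : ℕ) (s : ℝ) (α : 𝕋) :
    charFun (walkLaw μ n).toMeasure (s * phase α) =
      (avg s hfin.toFinset (fun g => (μ g).toReal) ^ n) 1 α := by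
  have hbound : ∀ x : ℂ, ‖Complex.exp ((inner ℝ x (s * phase α) : ℝ) * Complex.I)‖ ≤ 1 :=
    fun x => (Complex.norm_exp_ofReal_mul_I _).le
  have hintegrable : Integrable (fun x : ℂ =>
      Complex.exp ((inner ℝ x (s * phase α) : ℝ) * Complex.I)) (walkLaw μ n).toMeasure :=
    Integrable.of_bound (C := 1) (Continuous.aestronglyMeasurable (by fun_prop))
      (ae_of_all _ hbound)
  rw [charFun_apply, PMF.integral_eq_tsum _ _ hintegrable, ← expect_productLaw_circleRep]
  refine (expect_map (productLaw μ n) trans hbound).trans ?_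
  simp only [inner_mul_phase, circleRep_apply, ContinuousMap.one_apply, mul_one]

lemma rot_mul_self (g : rigidMotions) :
    rot (g * g) = Complex.exp ((2 * angle g : ℝ) * Complex.I) := by
  rw [rot_mul, rot, ← Complex.exp_add]
  push_cast
  ring_nf

lemma isGenericWalk_of_pmf (hfin : μ.support.Finite) (hdrift : drift μ = 0) {g₀ : rigidMotions}
    (hg₀ : g₀ ∈ μ.support) (hg₀_inv : g₀⁻¹ ∈ μ.support)
    (hcos : ∃ q : ℚ, Real.cos (2 * angle g₀) = q)
    (hhalf : ∀ k : ℤ, Real.cos (2 * angle g₀) ≠ k / 2) (htrans : ∃ g ∈ μ.support, trans g ≠ 0) :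
    IsGenericWalk hfin.toFinset (fun g => (μ g).toReal) g₀ where
  pos g hg := ENNReal.toReal_pos (hfin.mem_toFinset.mp hg) (μ.apply_ne_top g)
  sum_eq_one := sum_toReal_eq_one hfin
  drift_eq_zero := by
    simp only [← Complex.real_smul]
    exact (expect_eq_sum hfin trans).symm.trans hdrift
  mem := hfin.mem_toFinset.mpr hg₀
  inv_mem := hfin.mem_toFinset.mpr hg₀_inv
  exists_relation := by
    rw [rot_mul_self]
    exact exists_quadratic_relation_of_cos_rational hcos hhalf
  im_ne_zero := by
    rw [rot_mul_self, Complex.exp_ofReal_mul_I_im]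
    exact sin_ne_zero_of_cos_ne_int_div_two hhalf
  exists_trans_ne_zero := by simpa only [hfin.mem_toFinset] using htrans

lemma sq_sigma (hfin : μ.support.Finite) :
    sigma μ ^ 2 = sigmaSq hfin.toFinset fun g => (μ g).toReal := by
  have hsum : 1 / 2 * ∑' g, (μ g).toReal * ‖trans g‖ ^ 2 =
      sigmaSq hfin.toFinset fun g => (μ g).toReal :=
    congrArg (1 / 2 * ·) (expect_eq_sum hfin fun g => ‖trans g‖ ^ 2)
  rw [sigma, hsum, Real.sq_sqrt]
  unfold sigmaSq
  positivity

lemma trans_eq_zero_of_mem_support_productLaw (h : ∀ g ∈ μ.support, trans g = 0) (n : ℕ) :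
    ∀ g ∈ (productLaw μ n).support, trans g = 0 := by
  induction n with
  | zero => simp [productLaw]
  | succ n ih =>
    intro g hg
    rw [productLaw, PMF.mem_support_bind_iff] at hg
    obtain ⟨a, ha, hg⟩ := hg
    rw [PMF.support_map] at hg
    obtain ⟨b, hb, rfl⟩ := hg
    rw [trans_mul, h b hb, ih a ha, mul_zero, add_zero]

lemma walkLaw_eq_pure_zero (h : ∀ g ∈ μ.support, trans g = 0) (n : ℕ) :
    walkLaw μ n = PMF.pure 0 :=
  map_eq_pure_of_forall (trans_eq_zero_of_mem_support_productLaw h n)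

lemma sigma_eq_zero (h : ∀ g ∈ μ.support, trans g = 0) : sigma μ = 0 := by
  have hterm : ∀ g, (μ g).toReal * ‖trans g‖ ^ 2 = 0 := by
    intro g
    by_cases hg : g ∈ μ.support
    · simp [h g hg]
    · simp [(μ.apply_eq_zero_iff g).mpr hg]
  simp [sigma, hterm]

end WalkLaw

section Smoothing

/-- A continuous probability density `κ` on the plane supported in the disc of radius `δ`, used to
smooth laws at the scale `δ`. -/
structure IsMollifier (δ : ℝ) (κ : ℂ → ℝ) : Prop where
  continuous : Continuous κ
  nonneg : ∀ x, 0 ≤ κ x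
  eq_zero_of_le_norm : ∀ x, δ ≤ ‖x‖ → κ x = 0
  integral_eq_one : ∫ x, κ x = 1

/-- The density at `w` of the law `ν` smoothed by the kernel `κ`. -/
def smoothed (κ : ℂ → ℝ) (ν : Measure ℂ) (w : ℂ) : ℝ := ∫ y, κ (y - w) ∂ν

variable {κ : ℂ → ℝ} {δ : ℝ} {ν ν₁ ν₂ : Measure ℂ} [IsFiniteMeasure ν] [IsFiniteMeasure ν₁]
  [IsFiniteMeasure ν₂]

lemma IsMollifier.hasCompactSupport (hκ : IsMollifier δ κ) : HasCompactSupport κ :=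
  HasCompactSupport.intro (isCompact_closedBall 0 δ) fun x hx =>
    hκ.eq_zero_of_le_norm x (by simpa using (not_le.mp (mt mem_closedBall_zero_iff.mpr hx)).le)

lemma IsMollifier.integrable (hκ : IsMollifier δ κ) : Integrable κ :=
  hκ.continuous.integrable_of_hasCompactSupport hκ.hasCompactSupport

lemma IsMollifier.dist_lt_of_ne_zero (hκ : IsMollifier δ κ) {y w : ℂ} (h : κ (y - w) ≠ 0) :
    dist y w < δ := by
  rw [dist_eq_norm]
  exact not_le.mp (mt (hκ.eq_zero_of_le_norm _) h)

lemma IsMollifier.integrable_prod (hκ : IsMollifier δ κ) (ν : Measure ℂ) [IsFiniteMeasure ν]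
    (x₀ : ℂ) (r : ℝ) : Integrable (fun p : ℂ × ℂ => κ (p.2 - p.1))
      ((volume.restrict (Metric.ball x₀ r)).prod ν) := by
  have : IsFiniteMeasure (volume.restrict (Metric.ball x₀ r)) :=
    ⟨by rw [Measure.restrict_apply_univ]; exact measure_ball_lt_top⟩
  obtain ⟨M, hM⟩ := hκ.hasCompactSupport.exists_bound_of_continuous hκ.continuous
  exact Integrable.of_bound
    (hκ.continuous.comp (continuous_snd.sub continuous_fst)).aestronglyMeasurable M
    (ae_of_all _ fun p => hM _)

lemma IsMollifier.integrableOn_smoothed (hκ : IsMollifier δ κ) (x₀ : ℂ) (r : ℝ) :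
    IntegrableOn (smoothed κ ν) (Metric.ball x₀ r) :=
  (hκ.integrable_prod ν x₀ r).integral_prod_left

lemma IsMollifier.setIntegral_smoothed (hκ : IsMollifier δ κ) (x₀ : ℂ) (r : ℝ) :
    ∫ w in Metric.ball x₀ r, smoothed κ ν w = ∫ y, (∫ w in Metric.ball x₀ r, κ (y - w)) ∂ν :=
  integral_integral_swap (hκ.integrable_prod ν x₀ r)

lemma IsMollifier.setIntegral_sub_eq_one (hκ : IsMollifier δ κ) {x₀ y : ℂ} {r : ℝ}
    (hy : y ∈ Metric.ball x₀ r) : ∫ w in Metric.ball x₀ (r + δ), κ (y - w) = 1 := by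
  rw [setIntegral_eq_integral_of_forall_compl_eq_zero, integral_sub_left_eq_self κ volume y,
    hκ.integral_eq_one]
  intro w hw
  by_contra hne
  refine hw (Metric.mem_ball.mpr ?_)
  calc dist w x₀ ≤ dist y w + dist y x₀ := dist_triangle_left _ _ _
    _ < r + δ := by linarith [hκ.dist_lt_of_ne_zero hne, Metric.mem_ball.mp hy]

lemma IsMollifier.setIntegral_sub_le_one (hκ : IsMollifier δ κ) (A : Set ℂ) (y : ℂ) :
    ∫ w in A, κ (y - w) ≤ 1 := by
  rw [← hκ.integral_eq_one, ← integral_sub_left_eq_self κ volume y]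
  exact setIntegral_le_integral (hκ.integrable.comp_sub_left y) (ae_of_all _ fun w => hκ.nonneg _)

lemma IsMollifier.setIntegral_sub_eq_zero (hκ : IsMollifier δ κ) {x₀ y : ℂ} {r : ℝ}
    (hy : y ∉ Metric.ball x₀ r) : ∫ w in Metric.ball x₀ (r - δ), κ (y - w) = 0 := by
  refine setIntegral_eq_zero_of_forall_eq_zero fun w hw => ?_
  by_contra hne
  refine hy (Metric.mem_ball.mpr ?_)
  calc dist y x₀ ≤ dist y w + dist w x₀ := dist_triangle _ _ _
    _ < r := by linarith [hκ.dist_lt_of_ne_zero hne, Metric.mem_ball.mp hw]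

lemma integrable_indicator_ball_one (x₀ : ℂ) (r : ℝ) :
    Integrable ((Metric.ball x₀ r).indicator (1 : ℂ → ℝ)) ν :=
  (integrable_const (1 : ℝ)).indicator Metric.isOpen_ball.measurableSet

lemma IsMollifier.real_ball_le (hκ : IsMollifier δ κ) (x₀ : ℂ) (r : ℝ) :
    ν.real (Metric.ball x₀ r) ≤ ∫ w in Metric.ball x₀ (r + δ), smoothed κ ν w := by
  rw [hκ.setIntegral_smoothed, ← integral_indicator_one Metric.isOpen_ball.measurableSet]
  refine integral_mono (integrable_indicator_ball_one x₀ r)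
    (hκ.integrable_prod ν x₀ _).integral_prod_right fun y => ?_
  by_cases hy : y ∈ Metric.ball x₀ r
  · simpa [hy] using (hκ.setIntegral_sub_eq_one hy).ge
  · simpa [hy] using integral_nonneg fun w => hκ.nonneg (y - w)

lemma IsMollifier.le_real_ball (hκ : IsMollifier δ κ) (x₀ : ℂ) (r : ℝ) :
    ∫ w in Metric.ball x₀ (r - δ), smoothed κ ν w ≤ ν.real (Metric.ball x₀ r) := by
  rw [hκ.setIntegral_smoothed, ← integral_indicator_one Metric.isOpen_ball.measurableSet]
  refine integral_mono (hκ.integrable_prod ν x₀ _).integral_prod_right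
    (integrable_indicator_ball_one x₀ r) fun y => ?_
  by_cases hy : y ∈ Metric.ball x₀ r
  · simpa [hy] using hκ.setIntegral_sub_le_one (Metric.ball x₀ (r - δ)) y
  · simpa [hy] using (hκ.setIntegral_sub_eq_zero hy).le

lemma volume_real_ball (x₀ : ℂ) {r : ℝ} (hr : 0 ≤ r) :
    (volume : Measure ℂ).real (Metric.ball x₀ r) = Real.pi * r ^ 2 := by
  rw [Measure.real, Complex.volume_ball]
  simp [hr, mul_comm]

lemma IsMollifier.setIntegral_smoothed_le_add (hκ : IsMollifier δ κ) {a : ℝ}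
    (ha : ∀ w, |smoothed κ ν₁ w - smoothed κ ν₂ w| ≤ a) (x₀ : ℂ) {r : ℝ} (hr : 0 ≤ r) :
    ∫ w in Metric.ball x₀ r, smoothed κ ν₁ w ≤
      (∫ w in Metric.ball x₀ r, smoothed κ ν₂ w) + Real.pi * r ^ 2 * a := by
  have hconst : IntegrableOn (fun _ : ℂ => a) (Metric.ball x₀ r) :=
    integrableOn_const measure_ball_lt_top.ne
  calc ∫ w in Metric.ball x₀ r, smoothed κ ν₁ w
      ≤ ∫ w in Metric.ball x₀ r, (smoothed κ ν₂ w + a) :=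
        integral_mono (hκ.integrableOn_smoothed x₀ r)
          ((hκ.integrableOn_smoothed x₀ r).add hconst)
          fun w => by linarith [(abs_le.mp (ha w)).2]
    _ = _ := by
        rw [integral_add (hκ.integrableOn_smoothed x₀ r) hconst, setIntegral_const,
          volume_real_ball x₀ hr, smul_eq_mul]

lemma IsMollifier.setIntegral_smoothed_enlarge_le (hκ : IsMollifier δ κ) {b : ℝ}
    (hb : ∀ w, smoothed κ ν w ≤ b) (x₀ : ℂ) {r : ℝ} (hδ : 0 ≤ δ) (hδr : δ ≤ r) :
    ∫ w in Metric.ball x₀ (r + δ), smoothed κ ν w ≤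
      (∫ w in Metric.ball x₀ (r - δ), smoothed κ ν w) + b * (4 * Real.pi * r * δ) := by
  have hsub : Metric.ball x₀ (r - δ) ⊆ Metric.ball x₀ (r + δ) :=
    Metric.ball_subset_ball (by linarith)
  have hint := hκ.integrableOn_smoothed (ν := ν) x₀ (r + δ)
  have hfin : volume (Metric.ball x₀ (r + δ) \ Metric.ball x₀ (r - δ)) ≠ ⊤ :=
    ((measure_mono Set.sdiff_subset).trans_lt measure_ball_lt_top).ne
  have hannulus : ∫ w in Metric.ball x₀ (r + δ) \ Metric.ball x₀ (r - δ), smoothed κ ν w ≤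
      b * (4 * Real.pi * r * δ) :=
    calc _ ≤ ∫ _ in Metric.ball x₀ (r + δ) \ Metric.ball x₀ (r - δ), b :=
          integral_mono (hint.mono_set Set.sdiff_subset) (integrableOn_const hfin) hb
      _ = b * (4 * Real.pi * r * δ) := by
          rw [setIntegral_const, measureReal_sdiff hsub Metric.isOpen_ball.measurableSet,
            volume_real_ball x₀ (by linarith), volume_real_ball x₀ (by linarith), smul_eq_mul]
          ring
  have hsplit := integral_inter_add_sdiff (t := Metric.ball x₀ (r - δ))
    Metric.isOpen_ball.measurableSet hint
  rw [Set.inter_eq_self_of_subset_right hsub] at hsplit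
  linarith

lemma IsMollifier.real_ball_le_real_ball_add (hκ : IsMollifier δ κ) {a b : ℝ}
    (ha : ∀ w, |smoothed κ ν₁ w - smoothed κ ν₂ w| ≤ a) (hb : ∀ w, smoothed κ ν₂ w ≤ b)
    (x₀ : ℂ) {r : ℝ} (hδ : 0 ≤ δ) (hδr : δ ≤ r) :
    ν₁.real (Metric.ball x₀ r) ≤
      ν₂.real (Metric.ball x₀ r) + (a * (4 * Real.pi * r ^ 2) + b * (4 * Real.pi * r * δ)) := by
  have ha_nonneg : 0 ≤ a := (abs_nonneg _).trans (ha 0)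
  calc ν₁.real (Metric.ball x₀ r) ≤ ∫ w in Metric.ball x₀ (r + δ), smoothed κ ν₁ w :=
        hκ.real_ball_le x₀ r
    _ ≤ (∫ w in Metric.ball x₀ (r + δ), smoothed κ ν₂ w) + Real.pi * (r + δ) ^ 2 * a :=
        hκ.setIntegral_smoothed_le_add ha x₀ (by linarith)
    _ ≤ (∫ w in Metric.ball x₀ (r - δ), smoothed κ ν₂ w) + b * (4 * Real.pi * r * δ) +
          Real.pi * (r + r) ^ 2 * a := by
        gcongr
        · exact hκ.setIntegral_smoothed_enlarge_le hb x₀ hδ hδr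
        · linarith
    _ ≤ ν₂.real (Metric.ball x₀ r) + b * (4 * Real.pi * r * δ) + Real.pi * (r + r) ^ 2 * a := by
        gcongr
        exact hκ.le_real_ball x₀ r
    _ = _ := by ring

lemma IsMollifier.real_ball_sub_le_real_ball (hκ : IsMollifier δ κ) {a b : ℝ}
    (ha : ∀ w, |smoothed κ ν₁ w - smoothed κ ν₂ w| ≤ a) (hb : ∀ w, smoothed κ ν₂ w ≤ b)
    (x₀ : ℂ) {r : ℝ} (hδ : 0 ≤ δ) (hδr : δ ≤ r) :
    ν₂.real (Metric.ball x₀ r) ≤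
      ν₁.real (Metric.ball x₀ r) + (a * (4 * Real.pi * r ^ 2) + b * (4 * Real.pi * r * δ)) := by
  have ha_nonneg : 0 ≤ a := (abs_nonneg _).trans (ha 0)
  calc ν₂.real (Metric.ball x₀ r) ≤ ∫ w in Metric.ball x₀ (r + δ), smoothed κ ν₂ w :=
        hκ.real_ball_le x₀ r
    _ ≤ (∫ w in Metric.ball x₀ (r - δ), smoothed κ ν₂ w) + b * (4 * Real.pi * r * δ) :=
        hκ.setIntegral_smoothed_enlarge_le hb x₀ hδ hδr
    _ ≤ (∫ w in Metric.ball x₀ (r - δ), smoothed κ ν₁ w) + Real.pi * (r - δ) ^ 2 * a +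
          b * (4 * Real.pi * r * δ) := by
        gcongr
        exact hκ.setIntegral_smoothed_le_add (fun w => by rw [abs_sub_comm]; exact ha w) x₀
          (by linarith)
    _ ≤ ν₁.real (Metric.ball x₀ r) + Real.pi * (r + r) ^ 2 * a + b * (4 * Real.pi * r * δ) := by
        gcongr
        · exact hκ.le_real_ball x₀ r
        · linarith
    _ = _ := by ring

lemma IsMollifier.abs_real_ball_sub_le (hκ : IsMollifier δ κ) {a b : ℝ}
    (ha : ∀ w, |smoothed κ ν₁ w - smoothed κ ν₂ w| ≤ a) (hb : ∀ w, smoothed κ ν₂ w ≤ b)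
    (x₀ : ℂ) {r : ℝ} (hδ : 0 ≤ δ) (hδr : δ ≤ r) :
    |ν₁.real (Metric.ball x₀ r) - ν₂.real (Metric.ball x₀ r)| ≤
      a * (4 * Real.pi * r ^ 2) + b * (4 * Real.pi * r * δ) :=
  abs_sub_le_iff.mpr
    ⟨sub_le_iff_le_add'.mpr (hκ.real_ball_le_real_ball_add ha hb x₀ hδ hδr),
      sub_le_iff_le_add'.mpr (hκ.real_ball_sub_le_real_ball ha hb x₀ hδ hδr)⟩

end Smoothing

section Kernel

open scoped FourierTransform SchwartzMap ContDiff

lemma exists_schwartz_eq_integral_exp_inner {V : Type*} [NormedAddCommGroup V]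
    [InnerProductSpace ℝ V] [FiniteDimensional ℝ V] [MeasurableSpace V] [BorelSpace V]
    (f : 𝓢(V, ℂ)) : ∃ k : 𝓢(V, ℂ), ∀ x,
      f x = ∫ η, Complex.exp ((inner ℝ x η : ℝ) * Complex.I) * k η := by
  have hpi : (2 * Real.pi)⁻¹ ≠ 0 := inv_ne_zero Real.two_pi_pos.ne'
  set d := Module.finrank ℝ V
  set dil : V ≃L[ℝ] V := (LinearEquiv.smulOfNeZero ℝ V (2 * Real.pi)⁻¹ hpi).toContinuousLinearEquiv
  set k : 𝓢(V, ℂ) :=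
    ((2 * Real.pi)⁻¹ ^ d : ℝ) • SchwartzMap.compCLMOfContinuousLinearEquiv ℝ dil (𝓕 f)
  have hk : ∀ η, k η = ((2 * Real.pi)⁻¹ ^ d : ℝ) • 𝓕 f ((2 * Real.pi)⁻¹ • η) := fun η => rfl
  refine ⟨k, fun x => ?_⟩
  set G : V → ℂ := fun ξ => Complex.exp ((2 * Real.pi * inner ℝ ξ x : ℝ) * Complex.I) • 𝓕 f ξ
  have hinv : f x = ∫ ξ, G ξ := by
    conv_lhs => rw [← FourierTransform.fourierInv_fourier_eq f (F := 𝓢(V, ℂ))]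
    rw [SchwartzMap.fourierInv_coe, Real.fourierInv_eq']
  have hscale : ∀ η, Complex.exp ((inner ℝ x η : ℝ) * Complex.I) * k η =
      ((2 * Real.pi)⁻¹ ^ d : ℝ) • G ((2 * Real.pi)⁻¹ • η) := fun η => by
    simp only [G, hk, real_inner_smul_left, real_inner_comm x η, Complex.real_smul, smul_eq_mul]
    rw [mul_inv_cancel_left₀ Real.two_pi_pos.ne']
    ring
  simp_rw [hscale]
  rw [integral_smul, Measure.integral_comp_smul, abs_of_pos (by positivity), smul_smul,
    mul_inv_cancel₀ (by positivity), one_smul, hinv]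

/-- A mollifier `κ` at scale `δ` together with its inverse Fourier transform `k`. The constant `D`
controls `k` on its natural frequency scale `δ⁻¹`: it is bounded by `D` and decays like
`D (δ ‖η‖)⁻⁴`. -/
structure IsMollifierPair (δ D : ℝ) (κ : ℂ → ℝ) (k : ℂ → ℂ) : Prop extends IsMollifier δ κ where
  continuous_fourier : Continuous k
  integrable_fourier : Integrable k
  norm_fourier_le : ∀ η, ‖k η‖ ≤ D
  pow_mul_norm_fourier_le : ∀ η, (δ * ‖η‖) ^ 4 * ‖k η‖ ≤ D
  eq_integral_fourier : ∀ x,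
    (κ x : ℂ) = ∫ η, Complex.exp ((inner ℝ x η : ℝ) * Complex.I) * k η

lemma exists_isMollifierPair_one : ∃ D > 0, ∃ κ k, IsMollifierPair 1 D κ k := by
  let b : ContDiffBump (0 : ℂ) := ⟨1 / 2, 1, by norm_num, by norm_num⟩
  set κ : ℂ → ℝ := b.normed volume
  have hsupport : HasCompactSupport fun x => (κ x : ℂ) :=
    b.hasCompactSupport_normed.comp_left (g := fun t : ℝ => (t : ℂ)) Complex.ofReal_zero
  have hsmooth : ContDiff ℝ ∞ fun x => (κ x : ℂ) :=
    Complex.ofRealCLM.contDiff.comp b.contDiff_normed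
  obtain ⟨k, hk⟩ := exists_schwartz_eq_integral_exp_inner (hsupport.toSchwartzMap hsmooth)
  obtain ⟨D₀, hD₀, hbound⟩ := k.decay 0 0
  obtain ⟨D₄, hD₄, hdecay⟩ := k.decay 4 0
  simp only [norm_iteratedFDeriv_zero, pow_zero, one_mul] at hbound hdecay
  exact ⟨D₀ + D₄, by positivity, κ, k,
    { continuous := b.continuous_normed
      nonneg := b.nonneg_normed
      eq_zero_of_le_norm := fun x hx => by
        rw [← Function.notMem_support, b.support_normed_eq, mem_ball_zero_iff]
        exact not_lt.mpr hx
      integral_eq_one := b.integral_normed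
      continuous_fourier := k.continuous
      integrable_fourier := k.integrable
      norm_fourier_le := fun η => (hbound η).trans (by linarith)
      pow_mul_norm_fourier_le := fun η => by
        rw [one_mul]
        exact (hdecay η).trans (by linarith)
      eq_integral_fourier := hk }⟩

variable {κ : ℂ → ℝ} {k : ℂ → ℂ} {δ D : ℝ}

lemma IsMollifier.dilate (h : IsMollifier 1 κ) (hδ : 0 < δ) :
    IsMollifier δ fun x => (δ ^ 2)⁻¹ * κ (δ⁻¹ • x) where
  continuous := continuous_const.mul (h.continuous.comp (by fun_prop))
  nonneg x := mul_nonneg (by positivity) (h.nonneg _)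
  eq_zero_of_le_norm x hx := by
    rw [h.eq_zero_of_le_norm _ ?_, mul_zero]
    rwa [norm_smul, norm_inv, Real.norm_of_nonneg hδ.le, ← div_eq_inv_mul, one_le_div hδ]
  integral_eq_one := by
    rw [integral_const_mul, Measure.integral_comp_smul, Complex.finrank_real_complex,
      h.integral_eq_one, abs_of_pos (by positivity), smul_eq_mul, mul_one, inv_pow, inv_inv,
      inv_mul_cancel₀ (by positivity)]

lemma IsMollifierPair.dilate (h : IsMollifierPair 1 D κ k) (hδ : 0 < δ) :
    IsMollifierPair δ D (fun x => (δ ^ 2)⁻¹ * κ (δ⁻¹ • x)) fun η => k (δ • η) where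
  toIsMollifier := h.toIsMollifier.dilate hδ
  continuous_fourier := h.continuous_fourier.comp (by fun_prop)
  integrable_fourier := (integrable_comp_smul_iff volume k hδ.ne').mpr h.integrable_fourier
  norm_fourier_le η := h.norm_fourier_le _
  pow_mul_norm_fourier_le η := by
    simpa [norm_smul, abs_of_pos hδ] using h.pow_mul_norm_fourier_le (δ • η)
  eq_integral_fourier x := by
    have hchange := Measure.integral_comp_smul (volume : Measure ℂ) (fun ξ : ℂ =>
      Complex.exp ((inner ℝ (δ⁻¹ • x) ξ : ℝ) * Complex.I) * k ξ) δ
    rw [Complex.finrank_real_complex, abs_of_pos (by positivity), ← h.eq_integral_fourier]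
      at hchange
    rw [Complex.ofReal_mul, ← Complex.real_smul, ← hchange]
    simp only [real_inner_smul_left, real_inner_smul_right, mul_inv_cancel_left₀ hδ.ne']

lemma exists_isMollifierPair : ∃ D > 0, ∀ δ > 0, ∃ κ k, IsMollifierPair δ D κ k := by
  obtain ⟨D, hD, κ, k, h⟩ := exists_isMollifierPair_one
  exact ⟨D, hD, fun δ hδ => ⟨_, _, h.dilate hδ⟩⟩

variable {ν ν₁ ν₂ : Measure ℂ} [IsProbabilityMeasure ν] [IsProbabilityMeasure ν₁]
  [IsProbabilityMeasure ν₂]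

lemma IsMollifierPair.smoothed_eq_integral_charFun (h : IsMollifierPair δ D κ k) (w : ℂ) :
    (smoothed κ ν w : ℂ) =
      ∫ η, Complex.exp ((-inner ℝ w η : ℝ) * Complex.I) * k η * charFun ν η := by
  have hint : Integrable (fun p : ℂ × ℂ =>
      Complex.exp ((inner ℝ (p.1 - w) p.2 : ℝ) * Complex.I) * k p.2) (ν.prod volume) :=
    (h.integrable_fourier.comp_snd ν).bdd_mul (c := 1)
      (Continuous.aestronglyMeasurable (by fun_prop))
      (ae_of_all _ fun p => (Complex.norm_exp_ofReal_mul_I _).le)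
  rw [smoothed, ← integral_complex_ofReal]
  simp_rw [h.eq_integral_fourier]
  rw [integral_integral_swap hint]
  congr 1 with η
  rw [charFun_apply, ← integral_const_mul]
  congr 1 with y
  rw [inner_sub_left, mul_right_comm, ← Complex.exp_add]
  congr 2
  push_cast
  ring

lemma IsMollifierPair.integrable_mul_charFun (h : IsMollifierPair δ D κ k) (w : ℂ) :
    Integrable fun η => Complex.exp ((-inner ℝ w η : ℝ) * Complex.I) * k η * charFun ν η :=
  (h.integrable_fourier.bdd_mul (c := 1) (Continuous.aestronglyMeasurable (by fun_prop))
    (ae_of_all _ fun _ => (Complex.norm_exp_ofReal_mul_I _).le)).mul_bdd (c := 1)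
    continuous_charFun.aestronglyMeasurable (ae_of_all _ fun _ => norm_charFun_le_one _)

lemma norm_integral_exp_mul_le (k Δ : ℂ → ℂ) (w : ℂ) :
    ‖∫ η, Complex.exp ((-inner ℝ w η : ℝ) * Complex.I) * k η * Δ η‖ ≤ ∫ η, ‖k η‖ * ‖Δ η‖ := by
  refine (norm_integral_le_integral_norm _).trans_eq ?_
  simp only [norm_mul, Complex.norm_exp_ofReal_mul_I, one_mul]

lemma IsMollifierPair.abs_smoothed_sub_le (h : IsMollifierPair δ D κ k) (w : ℂ) :
    |smoothed κ ν₁ w - smoothed κ ν₂ w| ≤ ∫ η, ‖k η‖ * ‖charFun ν₁ η - charFun ν₂ η‖ := by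
  refine le_of_eq_of_le ?_ (norm_integral_exp_mul_le k (fun η => charFun ν₁ η - charFun ν₂ η) w)
  simp_rw [mul_sub]
  rw [integral_sub (h.integrable_mul_charFun w) (h.integrable_mul_charFun w),
    ← h.smoothed_eq_integral_charFun, ← h.smoothed_eq_integral_charFun, ← Complex.ofReal_sub,
    Complex.norm_real, Real.norm_eq_abs]

lemma IsMollifierPair.smoothed_le (h : IsMollifierPair δ D κ k) (w : ℂ) :
    smoothed κ ν w ≤ ∫ η, ‖k η‖ * ‖charFun ν η‖ := by
  refine le_trans ?_ (norm_integral_exp_mul_le k (charFun ν) w)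
  rw [← h.smoothed_eq_integral_charFun, Complex.norm_real]
  exact Real.le_norm_self _

end Kernel

section PolarCoordinates

lemma integral_norm_le_l2 (f : C(𝕋, ℂ)) : ∫ α, ‖f α‖ ≤ 3 * l2 f := by
  have hsq : Integrable fun α => ‖f α‖ ^ 2 := integrable_of_continuous_circle (by fun_prop)
  obtain ⟨I, hI⟩ : ∃ I, ∫ α, ‖f α‖ = I := ⟨_, rfl⟩
  have hamgm : ∀ x : ℝ, 2 * (I / 9) * x ≤ x ^ 2 + (I / 9) ^ 2 := fun x => by
    nlinarith [sq_nonneg (x - I / 9)]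
  have hyoung : 2 * (I / 9) * I ≤ l2 f ^ 2 + 2 * Real.pi * (I / 9) ^ 2 :=
    calc 2 * (I / 9) * I = ∫ α, 2 * (I / 9) * ‖f α‖ := by rw [integral_const_mul, hI]
      _ ≤ ∫ α, (‖f α‖ ^ 2 + (I / 9) ^ 2) :=
          integral_mono (integrable_of_continuous_circle (by fun_prop))
            (integrable_of_continuous_circle (by fun_prop)) fun α => hamgm ‖f α‖
      _ = l2 f ^ 2 + 2 * Real.pi * (I / 9) ^ 2 := by
          rw [integral_add hsq (integrable_const _), integral_const_circle, l2_sq]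
  have hsq_le : I ^ 2 ≤ (3 * l2 f) ^ 2 := by nlinarith [Real.pi_lt_d2, sq_nonneg I]
  rw [hI]
  exact le_of_abs_le (abs_le_of_sq_le_sq hsq_le (mul_nonneg (by norm_num) (apply_nonneg l2 f)))

lemma polarCoord_symm_eq_phase (s t : ℝ) :
    Complex.polarCoord.symm (s, t) = s * phase (t : 𝕋) := by
  rw [Complex.polarCoord_symm_apply, phase_coe, Complex.exp_mul_I]
  push_cast
  rfl

lemma lintegral_circle_eq {f : 𝕋 → ℝ} (hf : Continuous f) (hnonneg : ∀ α, 0 ≤ f α) :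
    ∫⁻ t in Set.Ioo (-Real.pi) Real.pi, ENNReal.ofReal (f (t : 𝕋)) =
      ENNReal.ofReal (∫ α, f α) := by
  rw [ofReal_integral_eq_lintegral_ofReal (integrable_of_continuous_circle hf)
    (ae_of_all _ hnonneg), ← AddCircle.lintegral_preimage (2 * Real.pi) (-Real.pi),
    show -Real.pi + 2 * Real.pi = Real.pi by ring]
  exact setLIntegral_congr Ioo_ae_eq_Ioc

lemma integral_le_of_circle_integral_le {f : ℂ → ℝ} (hf : Continuous f) (hnonneg : ∀ x, 0 ≤ f x)
    {G : ℝ → ℝ} (hG : IntegrableOn G (Set.Ioi 0)) (hG_nonneg : ∀ s, 0 < s → 0 ≤ G s)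
    (h : ∀ s : ℝ, 0 < s → s * ∫ α : 𝕋, f (s * phase α) ≤ G s) :
    ∫ x, f x ≤ ∫ s in Set.Ioi 0, G s := by
  have hG_ae : 0 ≤ᵐ[volume.restrict (Set.Ioi 0)] G :=
    (ae_restrict_iff' measurableSet_Ioi).mpr (ae_of_all _ hG_nonneg)
  have hmeas : Measurable fun p : ℝ × ℝ =>
      ENNReal.ofReal p.1 • ENNReal.ofReal (f (Complex.polarCoord.symm p)) := by
    simp_rw [Complex.polarCoord_symm_apply]
    have hcont : Continuous fun p : ℝ × ℝ =>
        f (p.1 * ((Real.cos p.2 : ℂ) + (Real.sin p.2 : ℂ) * Complex.I)) := by fun_prop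
    exact measurable_fst.ennreal_ofReal.smul hcont.measurable.ennreal_ofReal
  rw [integral_eq_lintegral_of_nonneg_ae (ae_of_all _ hnonneg) hf.aestronglyMeasurable]
  refine ENNReal.toReal_le_of_le_ofReal (integral_nonneg_of_ae hG_ae) ?_
  rw [ofReal_integral_eq_lintegral_ofReal hG hG_ae, ← Complex.lintegral_comp_polarCoord_symm,
    polarCoord_target, Measure.volume_eq_prod, ← Measure.prod_restrict,
    lintegral_prod _ hmeas.aemeasurable]
  refine setLIntegral_mono' measurableSet_Ioi fun s (hs : 0 < s) => ?_
  simp_rw [polarCoord_symm_eq_phase, smul_eq_mul]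
  rw [lintegral_const_mul' _ _ ENNReal.ofReal_ne_top,
    lintegral_circle_eq (f := fun α => f (s * phase α)) (by fun_prop) fun α => hnonneg _,
    ← ENNReal.ofReal_mul hs.le]
  exact ENNReal.ofReal_le_ofReal (h s hs)

end PolarCoordinates

section RadialIntegrals

lemma integrableOn_pow_mul_exp_neg_mul_sq (m : ℕ) {b : ℝ} (hb : 0 < b) :
    IntegrableOn (fun s : ℝ => s ^ m * Real.exp (-(b * s ^ 2))) (Set.Ioi 0) := by
  have h := integrableOn_rpow_mul_exp_neg_mul_sq hb (s := (m : ℝ))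
    (by linarith [m.cast_nonneg (α := ℝ)])
  simpa [Real.rpow_natCast, neg_mul] using h

lemma integral_pow_mul_exp_neg_mul_sq (m : ℕ) {b : ℝ} (hb : 0 < b) :
    ∫ s in Set.Ioi (0 : ℝ), s ^ m * Real.exp (-(b * s ^ 2)) =
      b ^ (-((m : ℝ) + 1) / 2) * (1 / 2) * Real.Gamma (((m : ℝ) + 1) / 2) := by
  have h := integral_rpow_mul_exp_neg_mul_rpow (p := 2) (q := (m : ℝ)) two_pos
    (by linarith [m.cast_nonneg (α := ℝ)]) hb
  simpa [Real.rpow_natCast, neg_mul] using h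

lemma exists_integral_pow_mul_exp_eq (m : ℕ) {c : ℝ} (hc : 0 < c) : ∃ A > 0, ∀ x > 0,
    ∫ s in Set.Ioi (0 : ℝ), s ^ m * Real.exp (-(c * x * s ^ 2)) =
      A * x ^ (-((m : ℝ) + 1) / 2) := by
  refine ⟨c ^ (-((m : ℝ) + 1) / 2) * (1 / 2) * Real.Gamma (((m : ℝ) + 1) / 2),
    mul_pos (by positivity) (Real.Gamma_pos_of_pos (by positivity)), fun x hx => ?_⟩
  rw [integral_pow_mul_exp_neg_mul_sq m (mul_pos hc hx), Real.mul_rpow hc.le hx.le]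
  ring

lemma low_frequency_integrand_eq (C c x s : ℝ) :
    s * (C * (x * s ^ 3 + s ^ 2) * Real.exp (-(c * x * s ^ 2))) =
      C * (x * (s ^ 4 * Real.exp (-(c * x * s ^ 2))) + s ^ 3 * Real.exp (-(c * x * s ^ 2))) := by
  ring

lemma integrableOn_low_frequency (C : ℝ) {c x : ℝ} (hc : 0 < c) (hx : 0 < x) : IntegrableOn
    (fun s : ℝ => s * (C * (x * s ^ 3 + s ^ 2) * Real.exp (-(c * x * s ^ 2)))) (Set.Ioi 0) := by
  simp_rw [low_frequency_integrand_eq]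
  exact (((integrableOn_pow_mul_exp_neg_mul_sq 4 (mul_pos hc hx)).const_mul x).add
    (integrableOn_pow_mul_exp_neg_mul_sq 3 (mul_pos hc hx))).const_mul C

lemma exists_integral_low_frequency_le {C c : ℝ} (hC : 0 < C) (hc : 0 < c) :
    ∃ K > 0, ∀ x : ℝ, 1 ≤ x → ∫ s in Set.Ioi (0 : ℝ),
      s * (C * (x * s ^ 3 + s ^ 2) * Real.exp (-(c * x * s ^ 2))) ≤ K * x ^ (-(3 / 2) : ℝ) := by
  obtain ⟨A, hA, hA_eq⟩ := exists_integral_pow_mul_exp_eq 4 hc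
  obtain ⟨B, hB, hB_eq⟩ := exists_integral_pow_mul_exp_eq 3 hc
  refine ⟨C * (A + B), by positivity, fun x hx => ?_⟩
  have hx0 : 0 < x := one_pos.trans_le hx
  have hquartic : x * x ^ (-((4 : ℕ) + 1 : ℝ) / 2) = x ^ (-(3 / 2) : ℝ) := by
    rw [← Real.rpow_one_add' hx0.le (by norm_num)]
    norm_num
  have hcubic : x ^ (-((3 : ℕ) + 1 : ℝ) / 2) ≤ x ^ (-(3 / 2) : ℝ) :=
    Real.rpow_le_rpow_of_exponent_le hx (by norm_num)
  simp_rw [low_frequency_integrand_eq]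
  rw [integral_const_mul,
    integral_add ((integrableOn_pow_mul_exp_neg_mul_sq 4 (mul_pos hc hx0)).const_mul x)
      (integrableOn_pow_mul_exp_neg_mul_sq 3 (mul_pos hc hx0)),
    integral_const_mul, hA_eq x hx0, hB_eq x hx0, mul_left_comm x A, hquartic, mul_assoc, add_mul]
  gcongr

lemma integrableOn_indicator_Ioc_const (R a : ℝ) :
    IntegrableOn ((Set.Ioc 0 R).indicator fun _ => a) (Set.Ioi 0) :=
  ((integrable_indicator_iff measurableSet_Ioc).mpr (integrableOn_const (by simp))).integrableOn

lemma integral_indicator_Ioc_const {R : ℝ} (hR : 0 ≤ R) (a : ℝ) :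
    ∫ s in Set.Ioi 0, (Set.Ioc 0 R).indicator (fun _ => a) s = R * a := by
  rw [setIntegral_indicator measurableSet_Ioc,
    Set.inter_eq_self_of_subset_right Set.Ioc_subset_Ioi_self, setIntegral_const, Measure.real,
    Real.volume_Ioc, sub_zero, ENNReal.toReal_ofReal hR, smul_eq_mul]

lemma integrableOn_indicator_Ioi_rpow {R : ℝ} (hR : 0 < R) (a : ℝ) :
    IntegrableOn ((Set.Ioi R).indicator fun s => a * s ^ (-3 : ℝ)) (Set.Ioi 0) :=
  ((integrable_indicator_iff measurableSet_Ioi).mpr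
    ((integrableOn_Ioi_rpow_of_lt (by norm_num) hR).const_mul a)).integrableOn

lemma integral_indicator_Ioi_rpow_le {R a : ℝ} (hR : 0 < R) (ha : 0 ≤ a) :
    ∫ s in Set.Ioi 0, (Set.Ioi R).indicator (fun s => a * s ^ (-3 : ℝ)) s ≤ a * (R ^ 2)⁻¹ := by
  rw [setIntegral_indicator measurableSet_Ioi,
    Set.inter_eq_self_of_subset_right (Set.Ioi_subset_Ioi hR.le), integral_const_mul,
    integral_Ioi_rpow_of_lt (by norm_num) hR, show (-3 + 1 : ℝ) = -2 by norm_num, neg_div_neg_eq,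
    Real.rpow_neg hR.le, Real.rpow_two]
  exact mul_le_mul_of_nonneg_left (half_le_self (by positivity)) ha

/-- The majorant, as a function of the radius `s`, for the mass of a Fourier integral on the circle
of radius `s`: the profile `g` plus an error `E` up to the cut-off `R`, and the tail `a s⁻³` beyond
it. -/
def radialMajorant (g : ℝ → ℝ) (E a R s : ℝ) : ℝ :=
  s * g s + (Set.Ioc 0 R).indicator (fun _ => R * E) s +
    (Set.Ioi R).indicator (fun s => a * s ^ (-3 : ℝ)) s

variable {g : ℝ → ℝ} {E a R s : ℝ}

lemma integrableOn_radialMajorant (hg : IntegrableOn (fun s => s * g s) (Set.Ioi 0))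
    (hR : 0 < R) : IntegrableOn (radialMajorant g E a R) (Set.Ioi 0) :=
  (hg.add (integrableOn_indicator_Ioc_const R _)).add (integrableOn_indicator_Ioi_rpow hR a)

lemma integral_radialMajorant_le (hg : IntegrableOn (fun s => s * g s) (Set.Ioi 0))
    (ha : 0 ≤ a) (hR : 0 < R) : ∫ s in Set.Ioi 0, radialMajorant g E a R s ≤
      (∫ s in Set.Ioi 0, s * g s) + R * (R * E) + a * (R ^ 2)⁻¹ := by
  simp_rw [radialMajorant]
  have hlow := integrableOn_indicator_Ioc_const R (R * E)
  rw [integral_add (by exact hg.add hlow) (integrableOn_indicator_Ioi_rpow hR a),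
    integral_add hg hlow, integral_indicator_Ioc_const hR.le]
  gcongr
  exact integral_indicator_Ioi_rpow_le hR ha

lemma mul_add_le_radialMajorant (hE : 0 ≤ E) (hs : 0 < s) (hsR : s ≤ R) :
    s * (g s + E) ≤ radialMajorant g E a R s := by
  rw [radialMajorant, Set.indicator_of_mem (Set.mem_Ioc.mpr ⟨hs, hsR⟩),
    Set.indicator_of_notMem (Set.notMem_Ioi.mpr hsR), add_zero, mul_add]
  gcongr

lemma mul_rpow_le_radialMajorant (hg : 0 ≤ g s) (hR : 0 < R) (hsR : R < s) :
    a * s ^ (-3 : ℝ) ≤ radialMajorant g E a R s := by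
  rw [radialMajorant, Set.indicator_of_mem (Set.mem_Ioi.mpr hsR),
    Set.indicator_of_notMem (fun h => hsR.not_ge h.2), add_zero]
  exact le_add_of_nonneg_left (mul_nonneg (hR.trans hsR).le hg)

end RadialIntegrals

section FrequencyRanges

lemma integral_norm_mul_norm_le_l2 {g : 𝕋 → ℂ} (hg : Continuous g) {B : ℝ}
    (hB : ∀ α, ‖g α‖ ≤ B) (f : C(𝕋, ℂ)) : ∫ α, ‖g α‖ * ‖f α‖ ≤ B * (3 * l2 f) :=
  calc ∫ α, ‖g α‖ * ‖f α‖ ≤ ∫ α, B * ‖f α‖ :=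
        integral_mono (integrable_of_continuous_circle (by fun_prop))
          (integrable_of_continuous_circle (by fun_prop))
          fun α => mul_le_mul_of_nonneg_right (hB α) (norm_nonneg _)
    _ = B * ∫ α, ‖f α‖ := integral_const_mul _ _
    _ ≤ B * (3 * l2 f) := mul_le_mul_of_nonneg_left (integral_norm_le_l2 f)
        ((norm_nonneg _).trans (hB 0))

variable {κ : ℂ → ℝ} {k : ℂ → ℂ} {δ D : ℝ}

lemma IsMollifierPair.bound_nonneg (h : IsMollifierPair δ D κ k) : 0 ≤ D :=
  (norm_nonneg _).trans (h.norm_fourier_le 0)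

lemma norm_mul_phase {s : ℝ} (hs : 0 ≤ s) (α : 𝕋) : ‖(s : ℂ) * phase α‖ = s := by
  rw [norm_mul, norm_phase, mul_one, Complex.norm_real, Real.norm_of_nonneg hs]

lemma IsMollifierPair.norm_fourier_mul_phase_le (h : IsMollifierPair δ D κ k) (hδ : 0 < δ)
    {s : ℝ} (hs : 0 < s) (α : 𝕋) : ‖k (s * phase α)‖ ≤ D * ((δ * s) ^ 4)⁻¹ := by
  have hdecay := h.pow_mul_norm_fourier_le (s * phase α)
  rw [norm_mul_phase hs.le] at hdecay
  rwa [← div_eq_mul_inv, le_div_iff₀' (by positivity)]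

lemma IsMollifierPair.integral_norm_mul_norm_le (h : IsMollifierPair δ D κ k) (hδ : 0 < δ)
    {Δ : ℂ → ℂ} (hΔ : Continuous Δ) {F : ℝ → C(𝕋, ℂ)}
    (hF : ∀ (s : ℝ) (α : 𝕋), Δ (s * phase α) = F s α)
    {g : ℝ → ℝ} (hg : IntegrableOn (fun s => s * g s) (Set.Ioi 0))
    (hg_nonneg : ∀ s, 0 < s → 0 ≤ g s) {A E R : ℝ} (hA : 0 ≤ A) (hE : 0 ≤ E) (hR : 0 < R)
    (hlow : ∀ s, 0 < s → s ≤ R → l2 (F s) ≤ g s + E) (hhigh : ∀ s, l2 (F s) ≤ A) :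
    ∫ η, ‖k η‖ * ‖Δ η‖ ≤
      3 * D * ((∫ s in Set.Ioi 0, s * g s) + R * (R * E) + A * (δ ^ 4)⁻¹ * (R ^ 2)⁻¹) := by
  have hD := h.bound_nonneg
  have hk := h.continuous_fourier
  have hcircle {s B : ℝ} (hB : ∀ α : 𝕋, ‖k (s * phase α)‖ ≤ B) :
      ∫ α : 𝕋, ‖k (s * phase α)‖ * ‖Δ (s * phase α)‖ ≤ B * (3 * l2 (F s)) := by
    simp_rw [hF]
    exact integral_norm_mul_norm_le_l2 (by fun_prop) hB (F s)
  have hmajorant : ∀ s : ℝ, 0 < s → s * ∫ α : 𝕋, ‖k (s * phase α)‖ * ‖Δ (s * phase α)‖ ≤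
      3 * D * radialMajorant g E (A * (δ ^ 4)⁻¹) R s := fun s hs => by
    rcases le_or_gt s R with hsR | hsR
    · calc s * ∫ α : 𝕋, ‖k (s * phase α)‖ * ‖Δ (s * phase α)‖
          ≤ s * (D * (3 * (g s + E))) := by
            gcongr
            exact (hcircle fun α => h.norm_fourier_le _).trans (by gcongr; exact hlow s hs hsR)
        _ = 3 * D * (s * (g s + E)) := by ring
        _ ≤ _ := by gcongr; exact mul_add_le_radialMajorant hE hs hsR
    · calc s * ∫ α : 𝕋, ‖k (s * phase α)‖ * ‖Δ (s * phase α)‖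
          ≤ s * (D * ((δ * s) ^ 4)⁻¹ * (3 * A)) := by
            gcongr
            exact (hcircle (h.norm_fourier_mul_phase_le hδ hs)).trans (by gcongr; exact hhigh s)
        _ = 3 * D * (A * (δ ^ 4)⁻¹ * s ^ (-3 : ℝ)) := by
            rw [Real.rpow_neg hs.le, show (3 : ℝ) = (3 : ℕ) by norm_num, Real.rpow_natCast]
            field_simp
        _ ≤ _ := by gcongr; exact mul_rpow_le_radialMajorant (hg_nonneg s hs) hR hsR
  calc ∫ η, ‖k η‖ * ‖Δ η‖
      ≤ ∫ s in Set.Ioi 0, 3 * D * radialMajorant g E (A * (δ ^ 4)⁻¹) R s :=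
        integral_le_of_circle_integral_le (by fun_prop) (fun η => by positivity)
          ((integrableOn_radialMajorant hg hR).const_mul _)
          (fun s hs => le_trans (mul_nonneg hs.le (integral_nonneg fun α => by positivity))
            (hmajorant s hs)) hmajorant
    _ = 3 * D * ∫ s in Set.Ioi 0, radialMajorant g E (A * (δ ^ 4)⁻¹) R s :=
        integral_const_mul _ _
    _ ≤ _ := by gcongr; exact integral_radialMajorant_le hg (by positivity) hR

lemma exists_sq_mul_exp_neg_le {β : ℝ} (hβ : 0 < β) : ∃ C > 0, ∀ x : ℝ, 1 ≤ x →
    x ^ 2 * Real.exp (-(β * x ^ (1 / 3 : ℝ))) ≤ C * x ^ (-(3 / 2) : ℝ) := by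
  refine ⟨(Nat.factorial 12 : ℕ) / β ^ 12, by positivity, fun x hx => ?_⟩
  have hx0 : 0 < x := one_pos.trans_le hx
  have htaylor := Real.pow_div_factorial_le_exp (β * x ^ (1 / 3 : ℝ)) (by positivity) 12
  have hpow : (x ^ (1 / 3 : ℝ)) ^ 12 = x ^ 4 := by
    rw [← Real.rpow_natCast, ← Real.rpow_mul hx0.le, ← Real.rpow_natCast]
    norm_num
  rw [mul_pow, hpow] at htaylor
  have hmono : (x ^ 2)⁻¹ ≤ x ^ (-(3 / 2) : ℝ) := by
    rw [← Real.rpow_natCast, ← Real.rpow_neg hx0.le]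
    exact Real.rpow_le_rpow_of_exponent_le hx (by norm_num)
  calc x ^ 2 * Real.exp (-(β * x ^ (1 / 3 : ℝ)))
      ≤ x ^ 2 * (β ^ 12 * x ^ 4 / (Nat.factorial 12 : ℕ))⁻¹ := by rw [Real.exp_neg]; gcongr
    _ = (Nat.factorial 12 : ℕ) / β ^ 12 * (x ^ 2)⁻¹ := by field_simp
    _ ≤ (Nat.factorial 12 : ℕ) / β ^ 12 * x ^ (-(3 / 2) : ℝ) := by gcongr

lemma middle_frequency_le {c β L : ℝ} (hβ : 0 < β) (hβ_one : β ≤ 1) (hβ_c : β ≤ c / 16)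
    (hL : 1 ≤ L) :
    Real.exp (β * L) * (Real.exp (β * L) *
      Real.exp (-(c * L ^ 3 / (1 + Real.log (Real.exp (β * L))) ^ 2))) ≤ Real.exp (-(β * L)) := by
  have hc : 0 < c := by linarith
  have hgap : 4 * β * L ≤ c * L ^ 3 / (1 + β * L) ^ 2 := by
    rw [le_div_iff₀ (by positivity)]
    calc 4 * β * L * (1 + β * L) ^ 2 ≤ 4 * (c / 16) * L * (2 * L) ^ 2 := by
          gcongr
          linarith [mul_le_mul_of_nonneg_right hβ_one (one_pos.trans_le hL).le]
      _ = c * L ^ 3 := by ring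
  rw [Real.log_exp, ← Real.exp_add, ← Real.exp_add, Real.exp_le_exp]
  nlinarith [mul_pos hβ (one_pos.trans_le hL)]

lemma high_frequency_le {x r y : ℝ} (hx : 0 < x) (hr : Real.exp (-y / 4) ≤ r) :
    ((r / √x) ^ 4)⁻¹ * (Real.exp y ^ 2)⁻¹ ≤ x ^ 2 * Real.exp (-y) := by
  have hr_pos : 0 < r := (Real.exp_pos _).trans_le hr
  have hr_four : Real.exp (-y) ≤ r ^ 4 :=
    calc Real.exp (-y) = Real.exp (-y / 4) ^ 4 := by
          rw [← Real.exp_nat_mul]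
          push_cast
          congr 1
          ring
      _ ≤ r ^ 4 := by gcongr
  have hsqrt : √x ^ 4 = x ^ 2 := by
    rw [show 4 = 2 * 2 from rfl, pow_mul, Real.sq_sqrt hx.le]
  calc ((r / √x) ^ 4)⁻¹ * (Real.exp y ^ 2)⁻¹
      = x ^ 2 * Real.exp (-y) * (Real.exp (-y) / r ^ 4) := by
        rw [div_pow, hsqrt, Real.exp_neg]
        field_simp
    _ ≤ x ^ 2 * Real.exp (-y) :=
        mul_le_of_le_one_right (by positivity) ((div_le_one (by positivity)).mpr hr_four)

end FrequencyRanges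

section Gaussian

/-- The law of `σ Z` for a standard Gaussian `Z` on the plane; the walk is compared with the one of
parameter `sigma μ * √n`. -/
def scaledGaussian (σ : ℝ) : Measure ℂ :=
  (stdGaussian ℂ).map fun z => σ • z

instance (σ : ℝ) : IsProbabilityMeasure (scaledGaussian σ) :=
  Measure.isProbabilityMeasure_map (by fun_prop)

lemma real_ball_scaledGaussian (σ : ℝ) (x₀ : ℂ) (r : ℝ) :
    (scaledGaussian σ).real (Metric.ball x₀ r) =
      (stdGaussian ℂ).real {z | σ • z ∈ Metric.ball x₀ r} :=
  map_measureReal_apply (by fun_prop) Metric.isOpen_ball.measurableSet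

lemma charFun_scaledGaussian (σ : ℝ) (t : ℂ) :
    charFun (scaledGaussian σ) t = (Real.exp (-(σ ^ 2 / 2 * ‖t‖ ^ 2)) : ℂ) := by
  rw [scaledGaussian, charFun_map_smul, charFun_stdGaussian, norm_smul, Real.norm_eq_abs,
    Complex.ofReal_exp, ← Complex.ofReal_pow, mul_pow, sq_abs]
  push_cast
  congr 1
  ring

lemma integral_exp_neg_mul_norm_sq {b : ℝ} (hb : 0 < b) :
    ∫ η : ℂ, Real.exp (-b * ‖η‖ ^ 2) = Real.pi / b := by
  rw [GaussianFourier.integral_rexp_neg_mul_sq_norm hb, Complex.finrank_real_complex, Nat.cast_two,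
    div_self two_ne_zero, Real.rpow_one]

lemma integral_norm_mul_norm_charFun_scaledGaussian_le {k : ℂ → ℂ} {D : ℝ}
    (hk : ∀ η, ‖k η‖ ≤ D) {σ : ℝ} (hσ : 0 < σ ^ 2) :
    ∫ η, ‖k η‖ * ‖charFun (scaledGaussian σ) η‖ ≤ D * (2 * Real.pi / σ ^ 2) := by
  have hintegral := integral_exp_neg_mul_norm_sq (half_pos hσ)
  have hintegrable : Integrable fun η : ℂ => Real.exp (-(σ ^ 2 / 2) * ‖η‖ ^ 2) :=
    .of_integral_ne_zero (hintegral.trans_ne (by positivity))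
  calc ∫ η, ‖k η‖ * ‖charFun (scaledGaussian σ) η‖
      ≤ ∫ η : ℂ, D * Real.exp (-(σ ^ 2 / 2) * ‖η‖ ^ 2) := by
        refine integral_mono_of_nonneg (ae_of_all _ fun η => by positivity)
          (hintegrable.const_mul D) (ae_of_all _ fun η => ?_)
        dsimp only
        rw [charFun_scaledGaussian, Complex.norm_real, Real.norm_of_nonneg (Real.exp_pos _).le,
          neg_mul]
        exact mul_le_mul_of_nonneg_right (hk η) (Real.exp_pos _).le
    _ = D * (2 * Real.pi / σ ^ 2) := by
        rw [integral_const_mul, hintegral]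
        field_simp

end Gaussian

section LocalLimit

variable {μ : PMF rigidMotions} (hfin : μ.support.Finite)

lemma charFun_sub_eq_charDiff (n : ℕ) (s : ℝ) (α : 𝕋) :
    charFun (walkLaw μ n).toMeasure (s * phase α) -
      charFun (scaledGaussian (sigma μ * √n)) (s * phase α) =
      charDiff hfin.toFinset (fun g => (μ g).toReal) n s α := by
  rw [charFun_walkLaw hfin, charFun_scaledGaussian, charDiff, ← sq_sigma hfin, norm_mul,
    norm_phase, mul_one, Complex.norm_real, Real.norm_eq_abs, sq_abs, mul_pow,
    Real.sq_sqrt n.cast_nonneg, ← Real.exp_nat_mul]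
  simp only [ContinuousMap.sub_apply, ContinuousMap.smul_apply, ContinuousMap.one_apply,
    smul_eq_mul, mul_one]
  ring_nf

lemma exists_integral_charFun_sub_le {g₀ : rigidMotions}
    (H : IsGenericWalk hfin.toFinset (fun g => (μ g).toReal) g₀) :
    ∃ c > 0, ∃ C > 0, ∀ N : ℕ, 1 ≤ N → ∀ r, Real.exp (-c * (N : ℝ) ^ (1 / 3 : ℝ)) < r →
      ∀ D κ k, IsMollifierPair (r / √N) D κ k →
      ∫ η, ‖k η‖ * ‖charFun (walkLaw μ N).toMeasure η -
        charFun (scaledGaussian (sigma μ * √N)) η‖ ≤ C * D * (N : ℝ) ^ (-(3 / 2) : ℝ) := by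
  obtain ⟨c, hc, C, hC, hlow⟩ := H.exists_l2_charDiff_le
  obtain ⟨K, hK, hK_le⟩ := exists_integral_low_frequency_le hC hc
  set β : ℝ := min 1 (c / 16)
  have hβ : 0 < β := lt_min one_pos (by positivity)
  obtain ⟨J, hJ, hJ_le⟩ := exists_sq_mul_exp_neg_le hβ
  refine ⟨β / 4, by positivity, 3 * (K + 12 * J), by positivity, fun N hN r hr D κ k h => ?_⟩
  have hN_one : (1 : ℝ) ≤ N := by exact_mod_cast hN
  have hN_pos : (0 : ℝ) < N := one_pos.trans_le hN_one
  have hr_pos : 0 < r := (Real.exp_pos _).trans hr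
  set L : ℝ := (N : ℝ) ^ (1 / 3 : ℝ)
  have hL : 1 ≤ L := Real.one_le_rpow hN_one (by norm_num)
  have hL_cube : L ^ 3 = N := by
    rw [← Real.rpow_natCast, ← Real.rpow_mul hN_pos.le]
    norm_num
  set R : ℝ := Real.exp (β * L)
  have hR : 1 ≤ R := Real.one_le_exp (by positivity)
  have hmiddle := middle_frequency_le hβ (min_le_left 1 (c / 16)) (min_le_right _ _) hL
  rw [hL_cube] at hmiddle
  have hhigh := high_frequency_le (y := β * L) hN_pos
    (le_trans (Real.exp_le_exp.mpr (by linarith)) hr.le)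
  have hone : Real.exp (-(β * L)) ≤ (N : ℝ) ^ 2 * Real.exp (-(β * L)) :=
    le_mul_of_one_le_left (Real.exp_pos _).le (one_le_pow₀ hN_one)
  have hsplit := h.integral_norm_mul_norm_le (by positivity)
    (continuous_charFun.sub continuous_charFun) (charFun_sub_eq_charDiff hfin N)
    (integrableOn_low_frequency C hc hN_pos) (fun s hs => by positivity) (by norm_num)
    (by positivity) (one_pos.trans_le hR) (fun s hs hsR => hlow N R s hR hs.le hsR)
    (H.l2_charDiff_le N)
  refine hsplit.trans ?_
  have hD := h.bound_nonneg
  rw [mul_right_comm 3 _ D, mul_assoc (3 * D)]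
  refine mul_le_mul_of_nonneg_left ?_ (by positivity)
  linarith [hK_le N hN_one, hJ_le N hN_one]

lemma inv_mul_sqrt_eq_rpow {N : ℝ} (hN : 0 < N) : (N * √N)⁻¹ = N ^ (-(3 / 2) : ℝ) := by
  rw [Real.rpow_neg hN.le, Real.sqrt_eq_rpow, ← Real.rpow_one_add' hN.le (by norm_num)]
  norm_num

lemma exists_local_limit {g₀ : rigidMotions}
    (H : IsGenericWalk hfin.toFinset (fun g => (μ g).toReal) g₀) :
    ∃ c > 0, ∃ C > 0, ∀ N : ℕ, 1 ≤ N → ∀ (x₀ : ℂ) (r : ℝ),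
      Real.exp (-c * (N : ℝ) ^ (1 / 3 : ℝ)) < r →
      |(walkLaw μ N).toMeasure.real (Metric.ball x₀ r) -
          (scaledGaussian (sigma μ * √N)).real (Metric.ball x₀ r)|
        ≤ C * (N : ℝ) ^ (-(3 / 2) : ℝ) * r ^ 2 := by
  obtain ⟨c, hc, C, hC, hdiff⟩ := exists_integral_charFun_sub_le hfin H
  obtain ⟨D, hD, hpair⟩ := exists_isMollifierPair
  have hσ : 0 < sigma μ ^ 2 := by
    rw [sq_sigma hfin]
    exact H.sigmaSq_pos
  refine ⟨c, hc, C * D * (4 * Real.pi) + D * (2 * Real.pi / sigma μ ^ 2) * (4 * Real.pi),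
    by positivity, fun N hN x₀ r hr => ?_⟩
  have hN_pos : (0 : ℝ) < N := by exact_mod_cast hN
  have hr_pos : 0 < r := (Real.exp_pos _).trans hr
  have hδr : r / √N ≤ r := div_le_self hr_pos.le (Real.one_le_sqrt.mpr (by exact_mod_cast hN))
  obtain ⟨κ, k, h⟩ := hpair (r / √N) (by positivity)
  have hσN : (sigma μ * √N) ^ 2 = sigma μ ^ 2 * N := by
    rw [mul_pow, Real.sq_sqrt hN_pos.le]
  have hdensity := integral_norm_mul_norm_charFun_scaledGaussian_le h.norm_fourier_le
    (hσN ▸ mul_pos hσ hN_pos)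
  calc |(walkLaw μ N).toMeasure.real (Metric.ball x₀ r) -
          (scaledGaussian (sigma μ * √N)).real (Metric.ball x₀ r)|
      ≤ C * D * (N : ℝ) ^ (-(3 / 2) : ℝ) * (4 * Real.pi * r ^ 2) +
          D * (2 * Real.pi / (sigma μ * √N) ^ 2) * (4 * Real.pi * r * (r / √N)) :=
        h.abs_real_ball_sub_le (fun w => (h.abs_smoothed_sub_le w).trans (hdiff N hN r hr D κ k h))
          (fun w => (h.smoothed_le w).trans hdensity) x₀ (by positivity) hδr
    _ = _ := by
        rw [← inv_mul_sqrt_eq_rpow hN_pos, hσN]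
        field_simp

lemma real_ball_walkLaw_eq_of_trans_eq_zero (htrans : ∀ g ∈ μ.support, trans g = 0) (N : ℕ)
    (x₀ : ℂ) (r : ℝ) : (walkLaw μ N).toMeasure.real (Metric.ball x₀ r) =
      (scaledGaussian (sigma μ * √N)).real (Metric.ball x₀ r) := by
  rw [walkLaw_eq_pure_zero htrans, sigma_eq_zero htrans, PMF.toMeasure_pure, scaledGaussian]
  simp only [zero_mul, zero_smul, Measure.map_const, measure_univ, one_smul]

lemma exp_neg_mul_rpow_le {c : ℝ} (hc : 0 ≤ c) {N : ℕ} (hN : 2 ≤ N) :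
    Real.exp (-c * (N : ℝ) ^ (1 / 3 : ℝ)) ≤
      Real.exp (-(c / 4) * (N : ℝ) ^ (1 / 3 : ℝ) / Real.log N ^ 2) := by
  have hlog : 1 / 2 ≤ Real.log N :=
    (by linarith [Real.log_two_gt_d9] : 1 / 2 ≤ Real.log 2).trans
      (Real.log_le_log two_pos (by exact_mod_cast hN))
  have hlog_sq : 1 / 4 ≤ Real.log N ^ 2 := by nlinarith
  have hx : 0 ≤ c * (N : ℝ) ^ (1 / 3 : ℝ) := by positivity
  rw [Real.exp_le_exp, le_div_iff₀ (by linarith)]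
  nlinarith

lemma IsSymmetric.inv_mem_support (h : IsSymmetric μ) {g : rigidMotions} (hg : g ∈ μ.support) :
    g⁻¹ ∈ μ.support := by
  rw [← show μ.map (·⁻¹) = μ from h, PMF.support_map]
  exact Set.mem_image_of_mem _ hg

end LocalLimit

end PlaneWalk

end

theorem theorem2_general (μ : PMF PlaneWalk.rigidMotions)
    (hfin : μ.support.Finite)
    (hdrift : PlaneWalk.drift μ = 0)
    (hcos : ∃ g ∈ μ.support, g⁻¹ ∈ μ.support ∧
      (∃ q : ℚ, Real.cos (2 * PlaneWalk.angle g) = q) ∧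
      ∀ k : ℤ, Real.cos (2 * PlaneWalk.angle g) ≠ k / 2) :
    ∃ c : ℝ, 0 < c ∧ ∃ C : ℝ, 0 < C ∧ ∀ N : ℕ, 1 ≤ N → ∀ (x₀ : ℂ) (r : ℝ),
      Real.exp (-c * (N : ℝ) ^ (1 / 3 : ℝ)) < r →
      |(PlaneWalk.walkLaw μ N).toMeasure.real (Metric.ball x₀ r) -
          (stdGaussian ℂ).real
            {z : ℂ | (PlaneWalk.sigma μ * Real.sqrt N) • z ∈ Metric.ball x₀ r}|
        ≤ C * (N : ℝ) ^ (-(3 / 2) : ℝ) * r ^ 2 := by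
  simp_rw [← PlaneWalk.real_ball_scaledGaussian]
  by_cases htrans : ∃ g ∈ μ.support, PlaneWalk.trans g ≠ 0
  · obtain ⟨g₀, hg₀, hg₀_inv, hrat, hhalf⟩ := hcos
    exact PlaneWalk.exists_local_limit hfin
      (PlaneWalk.isGenericWalk_of_pmf hfin hdrift hg₀ hg₀_inv hrat hhalf htrans)
  · push Not at htrans
    refine ⟨1, one_pos, 1, one_pos, fun N _ x₀ r _ => ?_⟩
    rw [PlaneWalk.real_ball_walkLaw_eq_of_trans_eq_zero htrans, sub_self, abs_zero]
    positivity

theorem theorem2 (μ : PMF PlaneWalk.rigidMotions)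
    (hfin : μ.support.Finite)
    (hsymm : PlaneWalk.IsSymmetric μ)
    (hdrift : PlaneWalk.drift μ = 0)
    (hcos : ∃ g ∈ μ.support,
      (∃ q : ℚ, Real.cos (PlaneWalk.angle g) = q) ∧
      ∀ k : ℤ, Real.cos (PlaneWalk.angle g) ≠ k / 2) :
    ∃ c : ℝ, 0 < c ∧ ∃ C : ℝ, 0 < C ∧ ∀ N : ℕ, 2 ≤ N → ∀ (x₀ : ℂ) (r : ℝ),
      Real.exp (-c * (N : ℝ) ^ (1 / 3 : ℝ) / Real.log N ^ 2) < r →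
      |(PlaneWalk.walkLaw μ N).toMeasure.real (Metric.ball x₀ r) -
          (stdGaussian ℂ).real
            {z : ℂ | (PlaneWalk.sigma μ * Real.sqrt N) • z ∈ Metric.ball x₀ r}|
        ≤ C * (N : ℝ) ^ (-(3 / 2) : ℝ) * r ^ 2 := by
  obtain ⟨g, hg, hrat, hhalf⟩ := hcos
  obtain ⟨c, hc, C, hC, hlocal⟩ := theorem2_general μ hfin hdrift
    ⟨g, hg, hsymm.inv_mem_support hg, PlaneWalk.exists_rat_cos_two_mul hrat,
      PlaneWalk.cos_two_mul_ne_int_div_two hrat hhalf⟩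
  exact ⟨c / 4, by positivity, C, hC, fun N hN x₀ r hr => hlocal N (by omega) x₀ r
    ((PlaneWalk.exp_neg_mul_rpow_le hc.le hN).trans_lt hr)⟩
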